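/- Let $\mathcal G$ be an $N$-player episodic general-sum Markov game ($N\ge 1$) with horizon $H\ge 1$, finite state space $\mathcal S$, finite nonempty action sets $\mathcal A_i$ ($A_i=|\mathcal A_i|$, $A_{\max}=\max_i A_i$, $\mathcal A_{\mathrm{all}}=\prod_i\mathcal A_i$), rewards $r_{h,i}:\mathcal S\times\mathcal A_{\mathrm{all}}\to[0,1]$, transitions $P_h(\cdot\mid s,\boldsymbol a)\in\Delta(\mathcal S)$ and a fixed initial state $s_1$. Write $[P_hV](s,\boldsymbol a)=\sum_{s'}P_h(s'\mid s,\boldsymbol a)V(s')$. For a product policy $\pi_h(s,\cdot)=\prod_i\pi_{h,i}(s,\cdot)$ and $Q:\mathcal S\times\mathcal A_{\mathrm{all}}\to\mathbb R$ write $[Q\pi_h](s)=\sum_{\boldsymbol a}Q(s,\boldsymbol a)\pi_h(s,\boldsymbol a)$ and $[Q\pi_{h,-i}](s,b)=\sum_{\boldsymbol a:\,a_i=b}Q(s,\boldsymbol a)\prod_{k\ne i}\pi_{h,k}(s,a_k)$. Let $\alpha_t=\frac{H+1}{H+t}$, $\alpha_t^j=\alpha_j\prod_{j'=j+1}^t(1-\alpha_{j'})$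 for $1\le j\le t$, and $w_j=\alpha_t^j/\alpha_t^1$ (independent of $t\ge j$). With full-information feedback, all agents run BM-OFTRL with learning rate $\eta=\frac{1}{256NH\sqrt{HA_{\max}}}$ for $T\ge 2$ iterations: $Q^0_{h,i}\equiv 0$, $\pi^0_{h,i}(s,\cdot)$ is uniform on $\mathcal A_i$, and for $t=1,\dots,T$, all $i,h,s$ and all $c,b\in\mathcal A_i$, $$\ell^{t,c}_{h,i}(s,b)=\sum_{j=1}^{t-1}w_j\,\pi^j_{h,i}(s,c)\,[Q^j_{h,i}\pi^j_{h,-i}](s,b)+w_t\,\pi^{t-1}_{h,i}(s,c)\,[Q^{t-1}_{h,i}\pi^{t-1}_{h,-i}](s,b),$$ $$q^{t,c}_{h,i}(s,\cdot)=\operatorname*{arg\,max}_{x\in\Delta(\mathcal A_i)}\Big(\frac{\eta}{w_t}\big\langle x,\ell^{t,c}_{h,i}(s,\cdot)\big\rangle+\sum_{b}\log x_b\Big),$$ $\pi^t_{h,i}(s,\cdot)\in\Delta(\mathcal A_i)$ satisfies $\pi^t_{h,i}(s,\cdot)=\sum_{c}\pi^t_{h,i}(s,c)\,q^{t,c}_{h,i}(s,\cdot)$,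 and, with $Q^t_{H+1,i}\equiv0$, $$Q^t_{h,i}(s,\boldsymbol a)=(1-\alpha_t)Q^{t-1}_{h,i}(s,\boldsymbol a)+\alpha_t\big(r_{h,i}+P_h[Q^t_{h+1,i}\pi^t_{h+1}]\big)(s,\boldsymbol a).$$ Let $\bar\pi$ be the output correlated policy: put $\tau_0=T$; at step $h=1,\dots,H$, using randomness common to all agents, draw $\tau_h\in\{1,\dots,\tau_{h-1}\}$ with $\mathbb P(\tau_h=j)=\alpha_{\tau_{h-1}}^j$ and let all agents play the product policy $\pi_h^{\tau_h}$ at step $h$. Let $V_{1,i}^{\pi}(s_1)$ denote the expected total reward of agent $i$ under a correlated policy $\pi$. A strategy modification $\phi_i$ of agent $i$ is a family of maps $\phi_{h,i}^s:\mathcal A_i\to\mathcal A_i$; under $\phi_i\diamond\pi$, whenever $\pi$ selects $\boldsymbol a$ at step $h$ and state $s$, agent $i$ plays $\phi_{h,i}^s(a_i)$ instead of $a_i$. Then $$\operatorname{CE-Gap}(\bar\pi):=\max_i\max_{\phi_i}\big(V_{1,i}^{\phi_i\diamond\bar\pi}(s_1)-V_{1,i}^{\bar\pi}(s_1)\big)\le\frac{6144\,N\,H^{7/2}A_{\max}^{5/2}\log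 T}{T}.$$ -/

import Mathlib

open scoped BigOperators

noncomputable section

namespace CEMarkov

universe u v

/-- Joint actions `𝒜_all = ×ᵢ 𝒜ᵢ`. -/
abbrev JointAction {N : ℕ} (A : Fin N → Type v) : Type v := ∀ i, A i

/-- An `N`-player episodic Markov game with horizon `H`, finite state space `S`, finite action
sets `A i`, rewards in `[0,1]`, transition kernels `P_h(· | s, a)` and a fixed initial state.
The steps `1, …, H` are numbered `0, …, H - 1`. -/
structure MarkovGame (N H : ℕ) (S : Type u) [Fintype S] (A : Fin N → Type v) where
  reward : Fin H → Fin N → S → JointAction A → ℝ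
  reward_mem : ∀ h i s a, reward h i s a ∈ Set.Icc (0 : ℝ) 1
  trans : Fin H → S → JointAction A → stdSimplex ℝ S
  init : S

/-- A Markov product policy: each agent `i` has, at each step and state, a mixed action. -/
abbrev ProductPolicy (N H : ℕ) (S : Type u) (A : Fin N → Type v) [∀ i, Fintype (A i)] :
    Type (max u v) :=
  (i : Fin N) → Fin H → S → stdSimplex ℝ (A i)

/-- A strategy modification of agent `i`: maps `φ_{h,i}^s : 𝒜ᵢ → 𝒜ᵢ`. -/
abbrev StrategyModification {N : ℕ} (H : ℕ) (S : Type u) (A : Fin N → Type v) (i : Fin N) :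
    Type (max u v) :=
  Fin H → S → A i → A i

/-! ### Correlated policies, values, and the CE-gap -/

section Correlated

variable {N H : ℕ} {S : Type u} [Fintype S] {A : Fin N → Type v} [∀ i, Fintype (A i)]

/-- A non-Markov correlated policy. The agents first draw a common seed `z : Z` from `seed`
(for example `Z = ℝ`); at step `h` the policy maps the seed, the history
`(s_1, a_1, …, s_{h-1}, a_{h-1})` and the current state to a distribution over joint actions. -/
structure CorrelatedPolicy (H : ℕ) (S : Type u) {N : ℕ} (A : Fin N → Type v)
    [∀ i, Fintype (A i)] (Z : Type) [MeasurableSpace Z] where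
  seed : MeasureTheory.Measure Z
  isProb : MeasureTheory.IsProbabilityMeasure seed
  act : (h : Fin H) → Z → (Fin h → S × JointAction A) → S → stdSimplex ℝ (JointAction A)
  measurable_act : ∀ h hist s a, Measurable fun z => (act h z hist s).1 a

variable {Z : Type} [MeasurableSpace Z]

/-- Part of a trajectory `(s_1, a_1, …, s_H, a_H)` before step `h`. -/
def history {X : Type*} (ω : Fin H → X) (h : Fin H) : Fin h → X :=
  fun k => ω (Fin.castLE h.is_lt.le k)

open scoped Classical in
/-- Probability that the state at step `h` is the one in `ω`, given the part of `ω` before `h`: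
the first state is the initial state, later ones are drawn from the transition kernel. -/
def stateProb (G : MarkovGame N H S A) (ω : Fin H → S × JointAction A) (h : Fin H) : ℝ :=
  if hh : (h : ℕ) = 0 then (if (ω h).1 = G.init then 1 else 0)
  else
    let p : Fin H := ⟨h - 1, by omega⟩
    (G.trans p (ω p).1 (ω p).2).1 (ω h).1

/-- Probability of the trajectory `ω` under the correlated policy, given the seed `z`. -/
def trajProb (G : MarkovGame N H S A) (π : CorrelatedPolicy H S A Z) (z : Z)
    (ω : Fin H → S × JointAction A) : ℝ :=
  ∏ h, stateProb G ω h * (π.act h z (history ω h) (ω h).1).1 (ω h).2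

/-- `V_{1,i}^π(s_1)`: expected total reward of agent `i`. -/
def value (G : MarkovGame N H S A) (π : CorrelatedPolicy H S A Z) (i : Fin N) : ℝ :=
  ∫ z, ∑ ω : Fin H → S × JointAction A,
    trajProb G π z ω * ∑ h, G.reward h i (ω h).1 (ω h).2 ∂π.seed

open scoped Classical in
/-- Law of `f a` when `a` has law `x`. -/
def pushSimplex {X Y : Type*} [Fintype X] [Fintype Y] (f : X → Y) (x : stdSimplex ℝ X) :
    stdSimplex ℝ Y :=
  ⟨fun y => ∑ a with f a = y, x.1 a, fun _ => Finset.sum_nonneg fun a _ => x.2.1 a, by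
    exact (Finset.sum_fiberwise Finset.univ f x.1).trans x.2.2⟩

/-- `φ ⋄ π`: whenever `π` selects `a` at step `h` and state `s`, the modified policy selects
`(a_1, …, φ_{h,i}^s(a_i), …, a_N)`. -/
def modify (i : Fin N) (φ : StrategyModification H S A i) (π : CorrelatedPolicy H S A Z) :
    CorrelatedPolicy H S A Z where
  seed := π.seed
  isProb := π.isProb
  act h z hist s := pushSimplex (fun a => Function.update a i (φ h s (a i))) (π.act h z hist s)
  measurable_act h hist s a := by
    simp only [pushSimplex]
    exact Finset.measurable_fun_sum _ fun b _ => π.measurable_act h hist s b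

/-- `CE-Gap(π) = max_i max_{φ_i} (V_{1,i}^{φ_i ⋄ π}(s_1) - V_{1,i}^π(s_1))`. -/
def ceGap (G : MarkovGame N H S A) (π : CorrelatedPolicy H S A Z) : ℝ :=
  ⨆ i : Fin N, ⨆ φ : StrategyModification H S A i, (value G (modify i φ π) i - value G π i)

end Correlated

/-! ### Step sizes and weights -/

/-- Step size `α_t = (H + 1) / (H + t)`. -/
def stepSize (H t : ℕ) : ℝ := ((H : ℝ) + 1) / ((H : ℝ) + t)

/-- `α_t^j = α_j ∏_{j' = j + 1}^t (1 - α_{j'})` for `1 ≤ j ≤ t`, and `0` otherwise. -/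
def stepWeight (H t j : ℕ) : ℝ :=
  if 1 ≤ j ∧ j ≤ t then stepSize H j * ∏ k ∈ Finset.Ioc j t, (1 - stepSize H k) else 0

/-- `w_j = α_t^j / α_t^1`; for `1 ≤ j ≤ t` this does not depend on `t`. -/
def oftrlWeight (H t j : ℕ) : ℝ := stepWeight H t j / stepWeight H t 1

/-! ### The learning dynamics -/

section Dynamics

variable {N H : ℕ} {S : Type u} [Fintype S] {A : Fin N → Type v} [∀ i, Fintype (A i)]

/-- Product of the mixed actions of all agents at step `h` and state `s`. -/
def jointMixed (π : ProductPolicy N H S A) (h : Fin H) (s : S) : stdSimplex ℝ (JointAction A) :=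
  ⟨fun a => ∏ i, (π i h s).1 (a i), fun a => Finset.prod_nonneg fun i _ => (π i h s).2.1 (a i), by
    rw [← Fintype.prod_sum]
    exact Finset.prod_eq_one fun i _ => (π i h s).2.2⟩

/-- `[Q π_h](s)`. -/
def evalJoint (Q : S → JointAction A → ℝ) (π : ProductPolicy N H S A) (h : Fin H) (s : S) : ℝ :=
  ∑ a, Q s a * (jointMixed π h s).1 a

open scoped Classical in
/-- `[Q π_{h,-i}](s, b)`: the others play `π_{h,-i}(s, ·)` and agent `i` plays `b`. -/
def evalOthers (Q : S → JointAction A → ℝ) (π : ProductPolicy N H S A) (h : Fin H) (i : Fin N)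
    (s : S) (b : A i) : ℝ :=
  ∑ a : JointAction A with a i = b, Q s a * ∏ k ∈ Finset.univ.erase i, (π k h s).1 (a k)

/-- `(r_{h,i} + P_h [Q_{h+1} π_{h+1}])(s, a)`, with `Q_{H+1} = 0`. -/
def bellman (G : MarkovGame N H S A) (i : Fin N) (Q : Fin H → S → JointAction A → ℝ)
    (π : ProductPolicy N H S A) (h : Fin H) (s : S) (a : JointAction A) : ℝ :=
  G.reward h i s a +
    if hh : (h : ℕ) + 1 < H then
      ∑ s', (G.trans h s a).1 s' * evalJoint (Q ⟨h + 1, hh⟩) π ⟨h + 1, hh⟩ s'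
    else 0

/-- The cumulative weighted utility, with the optimistic prediction, of the base algorithm of
action `c` of agent `i` at iteration `t`:
`ℓ^{t,c}(b) = ∑_{j=1}^{t-1} w_j π^j(c) [Q^j π_{-i}^j](b) + w_t π^{t-1}(c) [Q^{t-1} π_{-i}^{t-1}](b)`. -/
def cumUtility (π : ℕ → ProductPolicy N H S A)
    (Q : ℕ → Fin N → Fin H → S → JointAction A → ℝ)
    (t : ℕ) (i : Fin N) (h : Fin H) (s : S) (c b : A i) : ℝ :=
  ∑ j ∈ Finset.Ico 1 t,
      oftrlWeight H t j * (π j i h s).1 c * evalOthers (Q j i h) (π j) h i s b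
    + oftrlWeight H t t * (π (t - 1) i h s).1 c *
        evalOthers (Q (t - 1) i h) (π (t - 1)) h i s b

/-- Log-barrier regularizer `-∑_b log x_b` (meaningful where all coordinates are positive). -/
def logBarrier {X : Type*} [Fintype X] (x : X → ℝ) : ℝ := -∑ b, Real.log (x b)

/-- The points of the simplex at which the log-barrier is finite; it is `+∞` elsewhere, so the
maximization over the simplex is a maximization over this set. -/
def barrierDomain (X : Type*) [Fintype X] : Set (X → ℝ) :=
  {x | x ∈ stdSimplex ℝ X ∧ ∀ b, 0 < x b}

/-- `(π^t, q^t, Q^t)` is what is produced when all agents run BM-OFTRL with learning rate `η`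
for `T` iterations; `q t i h s c` is the output of the base algorithm of action `c`. -/
structure IsBMOFTRLRun (G : MarkovGame N H S A) (η : ℝ) (T : ℕ)
    (π : ℕ → ProductPolicy N H S A)
    (q : ℕ → (i : Fin N) → Fin H → S → A i → A i → ℝ)
    (Q : ℕ → Fin N → Fin H → S → JointAction A → ℝ) : Prop where
  init_Q : ∀ i h s a, Q 0 i h s a = 0
  init_policy : ∀ i h s b, (π 0 i h s).1 b = 1 / (Fintype.card (A i) : ℝ)
  base_mem : ∀ t, 1 ≤ t → t ≤ T → ∀ i h s c, q t i h s c ∈ barrierDomain (A i)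
  base_max : ∀ t, 1 ≤ t → t ≤ T → ∀ i h s c,
    IsMaxOn (fun x : A i → ℝ =>
        ∑ b, x b * (η * cumUtility π Q t i h s c b / oftrlWeight H t t) - logBarrier x)
      (barrierDomain (A i)) (q t i h s c)
  stationary : ∀ t, 1 ≤ t → t ≤ T → ∀ i h s b,
    (π t i h s).1 b = ∑ c, (π t i h s).1 c * q t i h s c b
  value_update : ∀ t, 1 ≤ t → t ≤ T → ∀ i h s a,
    Q t i h s a = (1 - stepSize H t) * Q (t - 1) i h s a
      + stepSize H t * bellman G i (Q t i) (π t) h s a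

/-! ### The certified output policy -/

/-- Probability that the successive draws `τ ∼ α_t^·`, `t ← τ`, started at `t`, give the
sequence `τ`: `∏_h α_{τ_{h-1}}^{τ_h}` with `τ_0 = t`. -/
def chainProb (H T : ℕ) {n : ℕ} (t : ℕ) (τ : Fin n → Finset.Icc 1 T) : ℝ :=
  ∏ k : Fin n,
    stepWeight H ((Fin.cons t (fun l => (τ l : ℕ)) : Fin (n + 1) → ℕ) k.castSucc) (τ k)

/-- Law of the sequence of sampled iterations. -/
def chainMeasure (H T n : ℕ) : MeasureTheory.Measure (Fin n → Finset.Icc 1 T) :=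
  ∑ τ : Fin n → Finset.Icc 1 T,
    ENNReal.ofReal (chainProb H T T τ) • MeasureTheory.Measure.dirac τ

theorem stepSize_le_one (H t : ℕ) (ht : 1 ≤ t) : stepSize H t ≤ 1 := by
  have : (1 : ℝ) ≤ t := by exact_mod_cast ht
  unfold stepSize
  rw [div_le_one (by positivity)]
  linarith

theorem stepWeight_nonneg (H t j : ℕ) : 0 ≤ stepWeight H t j := by
  unfold stepWeight
  split_ifs with h
  · refine mul_nonneg (by unfold stepSize; positivity) (Finset.prod_nonneg fun k hk => ?_)
    have := stepSize_le_one H k (by have := (Finset.mem_Ioc.1 hk).1; omega)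
    linarith
  · exact le_rfl

theorem sum_stepWeight (H t : ℕ) (ht : 1 ≤ t) : ∑ j ∈ Finset.Icc 1 t, stepWeight H t j = 1 := by
  induction t, ht using Nat.le_induction with
  | base =>
    have : (H : ℝ) + 1 ≠ 0 := by positivity
    simp [stepWeight, stepSize, this]
  | succ t ht ih =>
    rw [Finset.sum_Icc_succ_top (by omega)]
    have h1 : ∀ j ∈ Finset.Icc 1 t,
        stepWeight H (t + 1) j = stepWeight H t j * (1 - stepSize H (t + 1)) := by
      intro j hj
      obtain ⟨ha, hb⟩ := Finset.mem_Icc.1 hj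
      simp only [stepWeight, ha, hb, true_and, if_true, show j ≤ t + 1 by omega]
      rw [Finset.prod_Ioc_succ_top hb, mul_assoc]
    rw [Finset.sum_congr rfl h1, ← Finset.sum_mul, ih]
    simp [stepWeight]

theorem sum_stepWeight_subtype (H T t : ℕ) (h1 : 1 ≤ t) (h2 : t ≤ T) :
    ∑ j : Finset.Icc 1 T, stepWeight H t j = 1 := by
  rw [Finset.sum_coe_sort (Finset.Icc 1 T) (fun j => stepWeight H t j), ← sum_stepWeight H t h1]
  symm
  apply Finset.sum_subset (Finset.Icc_subset_Icc le_rfl h2)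
  intro j _ hj
  rw [Finset.mem_Icc] at hj
  simp [stepWeight, hj]

theorem chainProb_nonneg (H T : ℕ) {n : ℕ} (t : ℕ) (τ : Fin n → Finset.Icc 1 T) :
    0 ≤ chainProb H T t τ :=
  Finset.prod_nonneg fun _ _ => stepWeight_nonneg _ _ _

theorem sum_chainProb (H T n t : ℕ) (h1 : 1 ≤ t) (h2 : t ≤ T) :
    ∑ τ : Fin n → Finset.Icc 1 T, chainProb H T t τ = 1 := by
  induction n generalizing t with
  | zero => simp [chainProb]
  | succ n ih =>
    rw [← (Fin.consEquiv fun _ : Fin (n + 1) => ↥(Finset.Icc 1 T)).sum_comp,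
      Fintype.sum_prod_type]
    rw [← sum_stepWeight_subtype H T t h1 h2]
    refine Finset.sum_congr rfl fun x _ => ?_
    obtain ⟨ha, hb⟩ := Finset.mem_Icc.1 x.2
    rw [← mul_one (stepWeight H t x), ← ih x ha hb, Finset.mul_sum]
    refine Finset.sum_congr rfl fun τ _ => ?_
    simp only [chainProb, Fin.consEquiv_apply, Fin.prod_univ_succ]
    congr 1
    refine Finset.prod_congr rfl fun k _ => ?_
    congr 1
    rw [← Fin.succ_castSucc, Fin.cons_succ]
    refine Fin.cases ?_ (fun l => ?_) k.castSucc <;> simp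

theorem isProbabilityMeasure_chainMeasure (H T n : ℕ) (hT : 1 ≤ T) :
    MeasureTheory.IsProbabilityMeasure (chainMeasure H T n) := by
  constructor
  simp only [chainMeasure, MeasureTheory.Measure.finsetSum_apply, MeasureTheory.Measure.smul_apply,
    MeasureTheory.measure_univ, smul_eq_mul, mul_one]
  rw [← ENNReal.ofReal_sum_of_nonneg fun τ _ => chainProb_nonneg H T T τ,
    sum_chainProb H T n T hT le_rfl, ENNReal.ofReal_one]

/-- The output policy: starting with `t = T`, at each step draw `τ ≤ t` with probability
`α_t^τ`, play the product policy of iteration `τ` at that step, and set `t ← τ`. The draws do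
not depend on the play, so the whole sequence of draws is the common seed. -/
def certifiedPolicy (T : ℕ) (hT : 1 ≤ T) (π : ℕ → ProductPolicy N H S A) :
    CorrelatedPolicy H S A (Fin H → Finset.Icc 1 T) where
  seed := chainMeasure H T H
  isProb := isProbabilityMeasure_chainMeasure H T H hT
  act h τ _ s := jointMixed (π (τ h)) h s
  measurable_act _ _ _ _ := measurable_of_finite _

/-- `A_max = max_i |𝒜ᵢ|`. -/
def maxActions {N : ℕ} (A : Fin N → Type v) [∀ i, Fintype (A i)] : ℕ :=
  Finset.univ.sup fun i => Fintype.card (A i)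

end Dynamics

end CEMarkov

end

/-! The gap of the output policy reduces to weighted swap regrets at one step and state. As an
average of Bellman backups, `Q t` is exactly the action value of the policy that continues by
sampling from iteration `t` (`Q_eq`). An agent who deviates at index τ gains at most the
α_τ-weighted swap regret there plus the average of the later gains. If every such swap regret is at
most K/τ, then Σ_j α_τ^j / j ≤ (1 + 1/H)/τ (`sum_stepWeight_div_le`) preserves the shape 1/τ through
the recursion, and the total is K Σ_{l<H} (1 + 1/H)^l / T ≤ 2HK/T (`value_modify_sub_le`).

The bound K/τ, with K of order H A² log T / η, starts from the Blum–Mansour reduction: by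
stationarity, swap regret is the sum of the external regrets of the base algorithms. Optimistic FTRL
with the log-barrier bounds these by a term in log T, plus squared variations of the gains, minus
squared relative movements of the base outputs (`oftrl_regret_le`, `stability_le`). The stationary
distribution of a positive stochastic matrix is stable under relative perturbations of the rows,
with no spectral gap involved (`IsStationary.sum_abs_sub_le`), so the negative terms dominate the
squared ℓ¹ movement of the policy.

Finally, utilities move by at most α_t H plus H times the movement of all policies. The identity
modification has zero regret, so each agent's upper bound is nonnegative. After summation over
agents the negative movement terms outweigh the positive ones for this η, which bounds the total
movement and hence every single regret (`swapRegret_joint_le`). -/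

namespace CEMarkov

/-! ### Log-barrier: optimality conditions, Bregman divergence, stability of maximizers. -/

section LogBarrier

variable {X : Type*} [Fintype X]

/-- At a maximizer of `⟨x, θ⟩ + ∑ log x` over the simplex, `θ + 1 / x` is constant. -/
theorem add_inv_eq_of_isMaxOn {θ x : X → ℝ} (hx : x ∈ barrierDomain X)
    (hmax : IsMaxOn (fun y : X → ℝ => ∑ b, y b * θ b - logBarrier y) (barrierDomain X) x)
    (a b : X) : θ a + (x a)⁻¹ = θ b + (x b)⁻¹ := by
  classical
  obtain ⟨⟨hx0, hx1⟩, hpos⟩ := hx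
  by_cases hab : a = b
  · rw [hab]
  -- Shifting mass between `a` and `b` stays in the positive part of the simplex for small times of
  -- either sign, so the derivative along `v` vanishes at the maximizer.
  set v : X → ℝ := Pi.single a 1 - Pi.single b 1 with hv
  have hva : v a = 1 := by simp [hv, hab]
  have hvb : v b = -1 := by simp [hv, Ne.symm hab]
  have hvo : ∀ c, c ≠ a → c ≠ b → v c = 0 := fun c h1 h2 => by simp [hv, h1, h2]
  have hvs : ∑ c, v c = 0 := by simp [hv, Finset.sum_sub_distrib]
  let f : ℝ → ℝ := fun t => ∑ c, (x c + t * v c) * θ c - logBarrier fun c => x c + t * v c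
  have hev : ∀ᶠ t in nhds (0 : ℝ), ∀ c, 0 < x c + t * v c := by
    rw [Filter.eventually_all]
    intro c
    have hc : ContinuousAt (fun t : ℝ => x c + t * v c) 0 := by fun_prop
    exact hc.eventually (lt_mem_nhds (by simpa using hpos c))
  have hloc : IsLocalMax f 0 := by
    filter_upwards [hev] with t ht
    have hmem : (fun c => x c + t * v c) ∈ barrierDomain X := by
      refine ⟨⟨fun c => (ht c).le, ?_⟩, ht⟩
      rw [Finset.sum_add_distrib, ← Finset.mul_sum, hvs, hx1]
      simp
    have := hmax hmem
    simpa [f] using this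
  have hder : HasDerivAt f (∑ c, v c * (θ c + (x c)⁻¹)) 0 := by
    have h1 : ∀ c, HasDerivAt (fun t : ℝ => x c + t * v c) (v c) 0 := fun c => by
      simpa using ((hasDerivAt_id (0 : ℝ)).mul_const (v c)).const_add (x c)
    have h2 : HasDerivAt (fun t : ℝ => ∑ c, (x c + t * v c) * θ c) (∑ c, v c * θ c) 0 := by
      simpa using HasDerivAt.fun_sum fun c (_ : c ∈ Finset.univ) => (h1 c).mul_const (θ c)
    have h3 : HasDerivAt (fun t : ℝ => ∑ c, Real.log (x c + t * v c)) (∑ c, v c * (x c)⁻¹) 0 := by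
      have := HasDerivAt.fun_sum fun c (_ : c ∈ Finset.univ) =>
        (h1 c).log (by simpa using (hpos c).ne')
      simpa [div_eq_mul_inv] using this
    have h4 := h2.add h3
    rw [← Finset.sum_add_distrib] at h4
    refine (h4.congr_deriv (Finset.sum_congr rfl fun c _ => by ring)).congr_of_eventuallyEq
      (Filter.Eventually.of_forall fun t => ?_)
    simp [f, logBarrier]
  have h0 := hloc.hasDerivAt_eq_zero hder
  have hsum : ∑ c, v c * (θ c + (x c)⁻¹) = (θ a + (x a)⁻¹) - (θ b + (x b)⁻¹) := by
    simp [hv, sub_mul, Finset.sum_sub_distrib, Pi.single_apply]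
  linarith

/-- Bregman divergence of the log-barrier in terms of relative differences. -/
noncomputable def barrierDiv (y x : X → ℝ) : ℝ := ∑ b, ((y b / x b - 1) - Real.log (y b / x b))

theorem barrierDiv_nonneg {x y : X → ℝ} (hx : ∀ b, 0 < x b) (hy : ∀ b, 0 < y b) :
    0 ≤ barrierDiv y x :=
  Finset.sum_nonneg fun b _ => by
    have := Real.log_le_sub_one_of_pos (div_pos (hy b) (hx b))
    linarith

/-- The gap of the barrier-regularized objective to its maximum is the Bregman divergence. -/
theorem objective_add_barrierDiv {θ x y : X → ℝ} (hx : x ∈ barrierDomain X)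
    (hmax : IsMaxOn (fun y : X → ℝ => ∑ b, y b * θ b - logBarrier y) (barrierDomain X) x)
    (hy : y ∈ barrierDomain X) :
    (∑ b, y b * θ b - logBarrier y) + barrierDiv y x = ∑ b, x b * θ b - logBarrier x := by
  have hst := add_inv_eq_of_isMaxOn hx hmax
  obtain ⟨⟨-, hx1⟩, hxp⟩ := hx
  obtain ⟨⟨-, hy1⟩, hyp⟩ := hy
  have hne : Nonempty X := by
    by_contra h
    rw [not_nonempty_iff] at h
    simp at hx1
  obtain ⟨a⟩ := hne
  set l := θ a + (x a)⁻¹ with hl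
  -- In this form the multiplier `l` is paired with total mass one at both points and cancels, which
  -- leaves an equality.
  have hθ : ∀ b, θ b = l - (x b)⁻¹ := fun b => by rw [hl, hst a b]; ring
  have e1 : ∀ b, y b * θ b + (y b / x b - 1 - Real.log (y b / x b)) =
      l * y b - 1 - Real.log (y b) + Real.log (x b) := fun b => by
    rw [Real.log_div (hyp b).ne' (hxp b).ne', hθ b]
    field_simp
    ring
  have e2 : ∀ b, x b * θ b = l * x b - 1 := fun b => by
    have := (hxp b).ne'
    rw [hθ b]
    field_simp
  have e3 : ∑ b, y b * θ b + barrierDiv y x =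
      ∑ b, (l * y b - 1 - Real.log (y b) + Real.log (x b)) := by
    rw [barrierDiv, ← Finset.sum_add_distrib]
    exact Finset.sum_congr rfl fun b _ => e1 b
  have e4 : ∑ b, (l * y b - 1 - Real.log (y b) + Real.log (x b)) =
      ∑ b, x b * θ b - ∑ b, Real.log (y b) + ∑ b, Real.log (x b) := by
    rw [Finset.sum_congr rfl fun b _ => e2 b]
    simp only [Finset.sum_add_distrib, Finset.sum_sub_distrib, ← Finset.mul_sum, hy1, hx1]
  simp only [logBarrier]
  linarith

/-- Maximizers for close utilities are multiplicatively close. -/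
theorem abs_div_sub_one_le {θ θ' x x' : X → ℝ} {M : ℝ} (hx : x ∈ barrierDomain X)
    (hmax : IsMaxOn (fun y : X → ℝ => ∑ b, y b * θ b - logBarrier y) (barrierDomain X) x)
    (hx' : x' ∈ barrierDomain X)
    (hmax' : IsMaxOn (fun y : X → ℝ => ∑ b, y b * θ' b - logBarrier y) (barrierDomain X) x')
    (hM : ∀ b, |θ' b - θ b| ≤ M) (b : X) : |x' b / x b - 1| ≤ 2 * M := by
  have hst := add_inv_eq_of_isMaxOn hx hmax
  have hst' := add_inv_eq_of_isMaxOn hx' hmax'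
  obtain ⟨⟨hx0, hx1⟩, hxp⟩ := hx
  obtain ⟨⟨hx0', hx1'⟩, hxp'⟩ := hx'
  set l := θ b + (x b)⁻¹ with hl
  set l' := θ' b + (x' b)⁻¹ with hl'
  -- Difference of the two first-order conditions. Summed over `c`, it shows that `l' - l` is a
  -- weighted mean of `θ' - θ`, hence at most `M` in size.
  have hd : ∀ c, x' c - x c = x c * x' c * ((θ' c - θ c) - (l' - l)) := fun c => by
    have h1 : θ c = l - (x c)⁻¹ := by rw [hl, hst b c]; ring
    have h2 : θ' c = l' - (x' c)⁻¹ := by rw [hl', hst' b c]; ring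
    have := (hxp c).ne'
    have := (hxp' c).ne'
    rw [h1, h2]
    field_simp
    ring
  have hpp : 0 < ∑ c, x c * x' c :=
    Finset.sum_pos (fun c _ => mul_pos (hxp c) (hxp' c)) ⟨b, Finset.mem_univ b⟩
  have hz : ∑ c, x c * x' c * ((θ' c - θ c) - (l' - l)) = 0 := by
    rw [← Finset.sum_congr rfl fun c _ => hd c, Finset.sum_sub_distrib, hx1, hx1', sub_self]
  have hl1 : |l' - l| ≤ M := by
    rw [abs_le]
    constructor
    · by_contra! h
      have : 0 < ∑ c, x c * x' c * ((θ' c - θ c) - (l' - l)) :=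
        Finset.sum_pos (fun c _ => mul_pos (mul_pos (hxp c) (hxp' c)) (by
          have := (abs_le.1 (hM c)).1
          linarith)) ⟨b, Finset.mem_univ b⟩
      linarith
    · by_contra! h
      have : ∑ c, x c * x' c * ((θ' c - θ c) - (l' - l)) < 0 :=
        Finset.sum_neg (fun c _ => mul_neg_of_pos_of_neg (mul_pos (hxp c) (hxp' c)) (by
          have := (abs_le.1 (hM c)).2
          linarith)) ⟨b, Finset.mem_univ b⟩
      linarith
  have hxb : x' b ≤ 1 := by
    rw [← hx1']
    exact Finset.single_le_sum (fun c _ => hx0' c) (Finset.mem_univ b)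
  have e : x' b / x b - 1 = x' b * ((θ' b - θ b) - (l' - l)) := by
    have h := hd b
    have := (hxp b).ne'
    field_simp
    linarith
  rw [e, abs_mul, abs_of_pos (hxp' b)]
  have h3 : |(θ' b - θ b) - (l' - l)| ≤ 2 * M := (abs_sub _ _).trans (by linarith [hM b])
  calc x' b * |(θ' b - θ b) - (l' - l)| ≤ 1 * |(θ' b - θ b) - (l' - l)| := by gcongr
    _ ≤ 2 * M := by linarith

/-- The second-order Taylor remainder |z|³/(1 - |z|) uses up at most half of z²/2 when |z| ≤ 1/5. -/
theorem log_one_add_le {z : ℝ} (hz : |z| ≤ 1 / 5) : Real.log (1 + z) ≤ z - z ^ 2 / 4 := by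
  have h := (abs_le.1 (Real.abs_log_sub_add_sum_range_le (x := -z)
    (by rw [abs_neg]; linarith) 2)).2
  have h1 : |z| ^ 3 / (1 - |z|) ≤ |z| ^ 2 / 4 := by
    rw [div_le_iff₀ (by linarith)]
    nlinarith [sq_nonneg |z|]
  simp only [Finset.sum_range_succ, Finset.sum_range_zero, abs_neg, sub_neg_eq_add] at h
  norm_num at h
  rw [sq_abs] at h1
  linarith

theorem sq_sum_le_barrierDiv {x y : X → ℝ} (h : ∀ b, |y b / x b - 1| ≤ 1 / 5) :
    (∑ b, (y b / x b - 1) ^ 2) / 4 ≤ barrierDiv y x := by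
  rw [Finset.sum_div, barrierDiv]
  refine Finset.sum_le_sum fun b _ => ?_
  have := log_one_add_le (h b)
  rw [add_sub_cancel] at this
  linarith

/-- On the simplex the log-barrier is minimal at the uniform distribution. -/
theorem card_mul_log_le_logBarrier {x : X → ℝ} (hx : x ∈ barrierDomain X) :
    Fintype.card X * Real.log (Fintype.card X) ≤ logBarrier x := by
  obtain ⟨⟨-, hx1⟩, hp⟩ := hx
  rcases isEmpty_or_nonempty X with h | h
  · simp at hx1
  have hn : (0 : ℝ) < Fintype.card X := by exact_mod_cast Fintype.card_pos
  have h1 : ∑ b, Real.log (x b) ≤ ∑ b, (Fintype.card X * x b - 1 - Real.log (Fintype.card X)) :=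
    Finset.sum_le_sum fun b _ => by
      have := Real.log_le_sub_one_of_pos (mul_pos hn (hp b))
      rw [Real.log_mul hn.ne' (hp b).ne'] at this
      linarith
  simp only [Finset.sum_sub_distrib, ← Finset.mul_sum, hx1, Finset.sum_const, Finset.card_univ,
    nsmul_eq_mul] at h1
  simp only [logBarrier]
  linarith

end LogBarrier

/-! ### Perturbation of stationary distributions. -/

section Stationary

variable {X : Type*} [Fintype X]

/-- A strictly positive row-stochastic matrix. -/
def IsPosStochastic (P : X → X → ℝ) : Prop := ∀ c, P c ∈ barrierDomain X

/-- `p` is a stationary distribution of `P`. -/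
def IsStationary (P : X → X → ℝ) (p : X → ℝ) : Prop :=
  p ∈ stdSimplex ℝ X ∧ ∀ b, p b = ∑ c, p c * P c b

/-- Constants lie in the right kernel of 1 - P, so there is a nonzero left null vector v. Then |v| ≤
|v| P entrywise, and both sides have the same total mass, so |v| is invariant. -/
theorem exists_isStationary [Nonempty X] {P : X → X → ℝ} (hP : IsPosStochastic P) :
    ∃ p, IsStationary P p := by
  classical
  let M : Matrix X X ℝ := 1 - Matrix.of P
  have hdet : M.det = 0 := by
    rw [← Matrix.exists_mulVec_eq_zero_iff]
    refine ⟨fun _ => 1, fun h => ?_, ?_⟩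
    · obtain ⟨a⟩ := ‹Nonempty X›
      simpa using congrFun h a
    · ext c
      simp [M, Matrix.mulVec, dotProduct, (hP c).1.2, Matrix.one_apply]
  obtain ⟨v, hv0, hv⟩ := Matrix.exists_vecMul_eq_zero_iff.2 hdet
  have hv' : ∀ b, v b = ∑ c, v c * P c b := fun b => by
    have := congrFun hv b
    simp only [M, Matrix.vecMul, dotProduct, Matrix.sub_apply, Matrix.one_apply, Matrix.of_apply,
      mul_sub, Finset.sum_sub_distrib, mul_ite, mul_one, mul_zero, Finset.sum_ite_eq',
      Finset.mem_univ, if_true, Pi.zero_apply] at this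
    linarith
  have hle : ∀ b, |v b| ≤ ∑ c, |v c| * P c b := fun b => by
    conv_lhs => rw [hv' b]
    refine (Finset.abs_sum_le_sum_abs _ _).trans (Finset.sum_le_sum fun c _ => ?_)
    rw [abs_mul, abs_of_pos ((hP c).2 b)]
  have hsum : ∑ b, |v b| = ∑ b, ∑ c, |v c| * P c b := by
    rw [Finset.sum_comm]
    refine Finset.sum_congr rfl fun c _ => ?_
    rw [← Finset.mul_sum, (hP c).1.2, mul_one]
  have heq := (Finset.sum_eq_sum_iff_of_le fun b _ => hle b).1 hsum
  have hpos : 0 < ∑ b, |v b| := by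
    obtain ⟨a, ha⟩ := Function.ne_iff.1 hv0
    exact Finset.sum_pos' (fun b _ => abs_nonneg _) ⟨a, Finset.mem_univ a, abs_pos.2 ha⟩
  refine ⟨fun b => |v b| / ∑ c, |v c|, ⟨fun b => by positivity, ?_⟩, fun b => ?_⟩
  · rw [← Finset.sum_div, div_self hpos.ne']
  · dsimp only
    conv_lhs => rw [heq b (Finset.mem_univ b), Finset.sum_div]
    exact Finset.sum_congr rfl fun c _ => by ring

theorem IsStationary.pos {P : X → X → ℝ} (hP : IsPosStochastic P) {p : X → ℝ}
    (hp : IsStationary P p) (b : X) : 0 < p b := by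
  obtain ⟨⟨h0, h1⟩, h2⟩ := hp
  rw [h2 b]
  refine (Finset.sum_nonneg fun c _ => mul_nonneg (h0 c) ((hP c).2 b).le).lt_of_ne' fun h => ?_
  rw [Finset.sum_eq_zero_iff_of_nonneg fun c _ => mul_nonneg (h0 c) ((hP c).2 b).le] at h
  have : ∑ c, p c = 0 := Finset.sum_eq_zero fun c hc =>
    (mul_eq_zero.1 (h c hc)).resolve_right ((hP c).2 b).ne'
  linarith

/-- Maximum principle for the ratio of stationary distributions of matrices that differ in
one row. -/
theorem IsStationary.mul_le_of_row {P P' : X → X → ℝ} (hP : IsPosStochastic P)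
    {p p' : X → ℝ} (hp : IsStationary P p) (hp' : IsStationary P' p') (c : X)
    (hoff : ∀ a, a ≠ c → P' a = P a) {M : ℝ} (hM : ∀ b, P' c b ≤ M * P c b)
    (b : X) : p' b * p c ≤ M * p' c * p b := by
  have hpos := hp.pos hP
  obtain ⟨d, -, hd⟩ := Finset.exists_max_image Finset.univ (fun b => p' b / p b) ⟨b, Finset.mem_univ b⟩
  set r := p' d / p d with hr
  have hle : ∀ a, p' a ≤ r * p a := fun a => (div_le_iff₀ (hpos a)).1 (hd a (Finset.mem_univ a))
  -- Otherwise p' at the point `d` of maximal ratio would be strictly below r * p d: the rows other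
  -- than `c` contribute at most their share, and row `c` strictly less.
  have hc : r * p c ≤ M * p' c := by
    by_contra! h
    have h1 : p' d < r * p d := by
      calc p' d = ∑ a, p' a * P' a d := hp'.2 d
        _ < ∑ a, r * p a * P a d := by
          refine Finset.sum_lt_sum (fun a _ => ?_) ⟨c, Finset.mem_univ c, ?_⟩
          · by_cases hac : a = c
            · subst hac
              calc p' a * P' a d ≤ p' a * (M * P a d) :=
                    mul_le_mul_of_nonneg_left (hM d) (hp'.1.1 a)
                _ = M * p' a * P a d := by ring
                _ ≤ r * p a * P a d := mul_le_mul_of_nonneg_right h.le ((hP a).2 d).le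
            · rw [hoff a hac]
              exact mul_le_mul_of_nonneg_right (hle a) ((hP a).2 d).le
          · calc p' c * P' c d ≤ p' c * (M * P c d) :=
                  mul_le_mul_of_nonneg_left (hM d) (hp'.1.1 c)
              _ = M * p' c * P c d := by ring
              _ < r * p c * P c d := mul_lt_mul_of_pos_right h ((hP c).2 d)
        _ = r * p d := by
          rw [hp.2 d, Finset.mul_sum]
          exact Finset.sum_congr rfl fun a _ => by ring
    have h2 : r * p d = p' d := div_mul_cancel₀ _ (hpos d).ne'
    linarith
  calc p' b * p c ≤ r * p b * p c := mul_le_mul_of_nonneg_right (hle b) (hpos c).le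
    _ = r * p c * p b := by ring
    _ ≤ M * p' c * p b := mul_le_mul_of_nonneg_right hc (hpos b).le

/-- The maximum principle gives a factor M times p' c / p c. With the two matrices exchanged and a
sum over all states, it bounds this ratio by M too, hence the square. -/
theorem IsStationary.le_of_row {P P' : X → X → ℝ} (hP : IsPosStochastic P)
    (hP' : IsPosStochastic P') {p p' : X → ℝ} (hp : IsStationary P p) (hp' : IsStationary P' p')
    (c : X) (hoff : ∀ a, a ≠ c → P' a = P a) {M : ℝ} (hM0 : 0 ≤ M)
    (hM : ∀ b, P' c b ≤ M * P c b) (hM' : ∀ b, P c b ≤ M * P' c b) (b : X) :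
    p' b ≤ M ^ 2 * p b := by
  have h1 := hp.mul_le_of_row hP hp' c hoff hM b
  have h2 : p' c ≤ M * p c := by
    have := Finset.sum_le_sum fun b (_ : b ∈ Finset.univ) =>
      hp'.mul_le_of_row hP' hp c (fun a ha => (hoff a ha).symm) hM' b
    rw [← Finset.sum_mul, ← Finset.mul_sum, hp.1.2, hp'.1.2] at this
    linarith
  have hc := hp.pos hP c
  have hb := hp.pos hP b
  refine le_of_mul_le_mul_right ?_ hc
  calc p' b * p c ≤ M * p' c * p b := h1
    _ ≤ M * (M * p c) * p b := by gcongr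
    _ = M ^ 2 * p b * p c := by ring

/-- Relative perturbation bound for stationary distributions. -/
theorem IsStationary.le_exp_mul {P P' : X → X → ℝ} (hP : IsPosStochastic P)
    (hP' : IsPosStochastic P') {p p' : X → ℝ} (hp : IsStationary P p) (hp' : IsStationary P' p')
    {δ : X → ℝ} (h1 : ∀ c b, P' c b ≤ Real.exp (δ c) * P c b)
    (h2 : ∀ c b, P c b ≤ Real.exp (δ c) * P' c b) (b : X) :
    p' b ≤ Real.exp (2 * ∑ c, δ c) * p b := by
  classical
  have hne : Nonempty X := ⟨b⟩
  -- Rows are replaced one at a time; each hybrid matrix has a stationary distribution, and the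
  -- factors exp(2 δ a) multiply. The empty case is uniqueness, obtained from the row bound with M =
  -- 1.
  have key : ∀ s : Finset X, ∀ r, IsStationary (fun c => if c ∈ s then P' c else P c) r →
      ∀ b, r b ≤ Real.exp (2 * ∑ c ∈ s, δ c) * p b := by
    intro s
    induction s using Finset.induction_on with
    | empty =>
      intro r hr b
      have := hp.le_of_row hP hP (p' := r) (by simpa using hr) b (fun _ _ => rfl) zero_le_one
        (by simp) (by simp) b
      simpa using this
    | insert a s ha ih =>
      intro r hr b
      have hPs : ∀ s : Finset X, IsPosStochastic (fun c => if c ∈ s then P' c else P c) := by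
        intro s c
        dsimp only
        split_ifs
        · exact hP' c
        · exact hP c
      obtain ⟨r₀, hr₀⟩ := exists_isStationary (hPs s)
      have h3 := hr₀.le_of_row (hPs s) (hPs (insert a s)) hr a
        (fun c hc => by simp [hc]) (Real.exp_pos _).le
        (fun b => by simpa [ha] using h1 a b) (fun b => by simpa [ha] using h2 a b) b
      have h4 := ih r₀ hr₀ b
      rw [Finset.sum_insert ha]
      calc r b ≤ Real.exp (δ a) ^ 2 * r₀ b := h3
        _ ≤ Real.exp (δ a) ^ 2 * (Real.exp (2 * ∑ c ∈ s, δ c) * p b) := by gcongr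
        _ = _ := by
          rw [← mul_assoc, ← Real.exp_nat_mul, ← Real.exp_add]
          congr 2
          push_cast
          ring
  exact key Finset.univ p' (by simpa using hp') b

/-- Total variation perturbation bound for stationary distributions. -/
theorem IsStationary.sum_abs_sub_le {P P' : X → X → ℝ} (hP : IsPosStochastic P)
    (hP' : IsPosStochastic P') {p p' : X → ℝ} (hp : IsStationary P p) (hp' : IsStationary P' p')
    {ε : X → ℝ} (hε : ∀ c b, |P' c b / P c b - 1| ≤ ε c) (hsum : ∑ c, ε c ≤ 1 / 4) :
    ∑ b, |p' b - p b| ≤ 8 * ∑ c, ε c := by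
  have hε0 : ∀ c, 0 ≤ ε c := fun c => (abs_nonneg _).trans (hε c c)
  have hε1 : ∀ c, ε c ≤ 1 / 4 := fun c =>
    (Finset.single_le_sum (fun c _ => hε0 c) (Finset.mem_univ c)).trans hsum
  set E := ∑ c, ε c with hE
  have hE0 : 0 ≤ E := Finset.sum_nonneg fun c _ => hε0 c
  -- The exponent 2ε serves both directions, because exp(2ε)(1 - ε) ≥ 1 for ε ≤ 1/4.
  have b1 : ∀ c b, P' c b ≤ Real.exp (2 * ε c) * P c b := fun c b => by
    have h := (abs_le.1 (hε c b)).2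
    have h0 := (hP c).2 b
    rw [← div_le_iff₀ h0]
    have := Real.add_one_le_exp (2 * ε c)
    linarith [hε0 c]
  have b2 : ∀ c b, P c b ≤ Real.exp (2 * ε c) * P' c b := fun c b => by
    have h := (abs_le.1 (hε c b)).1
    have h0 := (hP c).2 b
    have h3 : (1 - ε c) * P c b ≤ P' c b := by
      rw [← le_div_iff₀ h0]; linarith
    have h4 : 1 ≤ Real.exp (2 * ε c) * (1 - ε c) := by
      have := Real.add_one_le_exp (2 * ε c)
      nlinarith [hε0 c, hε1 c]
    calc P c b ≤ Real.exp (2 * ε c) * (1 - ε c) * P c b := le_mul_of_one_le_left h0.le h4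
      _ = Real.exp (2 * ε c) * ((1 - ε c) * P c b) := by ring
      _ ≤ _ := by gcongr
  have e : 2 * ∑ c, 2 * ε c = 4 * E := by rw [← Finset.mul_sum]; ring
  have u1 := fun b => hp.le_exp_mul hP hP' hp' b1 b2 b
  have u2 := fun b => hp'.le_exp_mul hP' hP hp b2 b1 b
  rw [e] at u1 u2
  have hexp : Real.exp (4 * E) ≤ 1 + 8 * E := by
    have := Real.abs_exp_sub_one_le (x := 4 * E) (by rw [abs_of_nonneg] <;> linarith)
    rw [abs_of_nonneg (a := 4 * E) (by linarith)] at this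
    linarith [(abs_le.1 this).2]
  have hexp' : 1 - 4 * E ≤ Real.exp (-(4 * E)) := by
    have := Real.add_one_le_exp (-(4 * E))
    linarith
  calc ∑ b, |p' b - p b| ≤ ∑ b, 8 * E * p b := Finset.sum_le_sum fun b _ => by
        have hb := hp.1.1 b
        rw [abs_le]
        constructor
        · have h5 : Real.exp (-(4 * E)) * p b ≤ p' b := by
            rw [Real.exp_neg, inv_mul_le_iff₀ (Real.exp_pos _)]
            exact u2 b
          nlinarith [mul_le_mul_of_nonneg_right hexp' hb]
        · nlinarith [mul_le_mul_of_nonneg_right hexp hb, u1 b]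
    _ = 8 * E := by rw [← Finset.mul_sum, hp.1.2, mul_one]

end Stationary

/-! ### Identities and bounds for α_t^j and w_j. -/

section Weights

variable {H : ℕ}

theorem one_sub_stepSize (H t : ℕ) (ht : 1 ≤ t) :
    1 - stepSize H t = ((t : ℝ) - 1) / (H + t) := by
  have : (0 : ℝ) < t := by exact_mod_cast ht
  rw [stepSize]
  field_simp
  ring

theorem stepWeight_succ {t j : ℕ} (hj : j ≤ t) :
    stepWeight H (t + 1) j = stepWeight H t j * (1 - stepSize H (t + 1)) := by
  by_cases h : 1 ≤ j
  · simp only [stepWeight, h, hj, true_and, if_true, show j ≤ t + 1 by omega]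
    rw [Finset.prod_Ioc_succ_top hj, mul_assoc]
  · simp [stepWeight, h]

theorem stepWeight_self {t : ℕ} (ht : 1 ≤ t) : stepWeight H t t = stepSize H t := by
  simp [stepWeight, ht]

/-- The product starts at k = 2, so the vanishing factor 1 - α_1 never enters; the quotients w_j are
therefore genuine. -/
theorem stepWeight_one_pos {t : ℕ} (ht : 1 ≤ t) : 0 < stepWeight H t 1 := by
  induction t, ht using Nat.le_induction with
  | base => rw [stepWeight_self le_rfl, stepSize]; positivity
  | succ t ht ih =>
    have : (0 : ℝ) < t := by exact_mod_cast ht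
    rw [stepWeight_succ ht, one_sub_stepSize H _ (by omega)]
    refine mul_pos ih ?_
    push_cast
    rw [add_sub_cancel_right]
    positivity

/-- Raising t multiplies numerator and denominator by the same nonzero factor 1 - α_{t+1}. From here
on w_j is written `oftrlWeight H j j`. -/
theorem oftrlWeight_eq {t j : ℕ} (hj : 1 ≤ j) (hjt : j ≤ t) :
    oftrlWeight H t j = oftrlWeight H j j := by
  induction t, hjt using Nat.le_induction with
  | base => rfl
  | succ t ht ih =>
    have h1 := one_sub_stepSize H (t + 1) (by omega)
    have : (0 : ℝ) < t := by exact_mod_cast hj.trans ht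
    push_cast at h1
    rw [add_sub_cancel_right] at h1
    have h2 : 1 - stepSize H (t + 1) ≠ 0 := by rw [h1]; positivity
    rw [← ih, oftrlWeight, oftrlWeight, stepWeight_succ ht, stepWeight_succ (hj.trans ht),
      mul_div_mul_right _ _ h2]

theorem stepWeight_eq {t j : ℕ} (hj : 1 ≤ j) (hjt : j ≤ t) :
    stepWeight H t j = stepWeight H t 1 * oftrlWeight H j j := by
  rw [← oftrlWeight_eq hj hjt, oftrlWeight, mul_div_cancel₀]
  exact (stepWeight_one_pos (hj.trans hjt)).ne'

theorem oftrlWeight_pos {t : ℕ} (ht : 1 ≤ t) : 0 < oftrlWeight H t t := by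
  have ht' : (0 : ℝ) < t := by exact_mod_cast ht
  rw [oftrlWeight, stepWeight_self ht, stepSize]
  have := stepWeight_one_pos (H := H) ht
  positivity

theorem oftrlWeight_succ {t : ℕ} (ht : 1 ≤ t) :
    oftrlWeight H (t + 1) (t + 1) = oftrlWeight H t t * (1 + H / t) := by
  have ht' : (0 : ℝ) < t := by exact_mod_cast ht
  have h1 := one_sub_stepSize H (t + 1) (by omega)
  push_cast at h1
  rw [add_sub_cancel_right] at h1
  have := (stepWeight_one_pos (H := H) ht).ne'
  rw [oftrlWeight, oftrlWeight, stepWeight_self ht, stepWeight_self (by omega), stepWeight_succ ht,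
    h1, stepSize, stepSize]
  push_cast
  field_simp
  ring

theorem oftrlWeight_le_succ {t : ℕ} (ht : 1 ≤ t) :
    oftrlWeight H t t ≤ oftrlWeight H (t + 1) (t + 1) := by
  rw [oftrlWeight_succ ht]
  exact le_mul_of_one_le_right (oftrlWeight_pos ht).le (by
    have : (0 : ℝ) ≤ H / t := by positivity
    linarith)

theorem oftrlWeight_succ_le {t : ℕ} (hH : 1 ≤ H) (ht : 1 ≤ t) :
    oftrlWeight H (t + 1) (t + 1) ≤ 2 * H * oftrlWeight H t t := by
  rw [oftrlWeight_succ ht, mul_comm (2 * (H : ℝ))]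
  refine mul_le_mul_of_nonneg_left ?_ (oftrlWeight_pos ht).le
  have ht' : (1 : ℝ) ≤ t := by exact_mod_cast ht
  have hH' : (1 : ℝ) ≤ H := by exact_mod_cast hH
  have : (H : ℝ) / t ≤ H := div_le_self (by positivity) ht'
  linarith

theorem sum_oftrlWeight_Ico {t : ℕ} (ht : 1 ≤ t) :
    ∑ j ∈ Finset.Ico 1 t, oftrlWeight H j j = oftrlWeight H t t * (t - 1) / (H + 1) := by
  induction t, ht using Nat.le_induction with
  | base => simp
  | succ t ht ih =>
    have ht' : (0 : ℝ) < t := by exact_mod_cast ht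
    rw [Finset.sum_Ico_succ_top ht, ih, oftrlWeight_succ ht]
    push_cast
    field_simp
    ring

/-- Rescaling the accumulated gains from 1/w_t to 1/w_{t+1} costs no more than one round of utility;
this is what keeps the base iterates stable. -/
theorem sum_oftrlWeight_mul_le {t : ℕ} (ht : 1 ≤ t) :
    (∑ j ∈ Finset.Ico 1 t, oftrlWeight H j j) *
      ((oftrlWeight H t t)⁻¹ - (oftrlWeight H (t + 1) (t + 1))⁻¹) ≤ 1 := by
  have ht' : (1 : ℝ) ≤ t := by exact_mod_cast ht
  have hw := (oftrlWeight_pos (H := H) ht).ne'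
  rw [sum_oftrlWeight_Ico ht, oftrlWeight_succ ht]
  have e : oftrlWeight H t t * (t - 1) / (H + 1) *
      ((oftrlWeight H t t)⁻¹ - (oftrlWeight H t t * (1 + H / t))⁻¹) =
      ((t - 1) / (t + H)) * (H / (H + 1)) := by
    field_simp
    ring
  rw [e]
  have h1 : ((t : ℝ) - 1) / (t + H) ≤ 1 := by
    rw [div_le_one (by positivity)]
    have : (0 : ℝ) ≤ H := by positivity
    linarith
  have h2 : (H : ℝ) / (H + 1) ≤ 1 := by
    rw [div_le_one (by positivity)]
    linarith
  exact mul_le_one₀ h1 (by positivity) h2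

/-- The right side solves the one-step recursion in t exactly, so only the base case has slack. -/
theorem sum_stepWeight_div_le (hH : 1 ≤ H) {t : ℕ} (ht : 1 ≤ t) :
    ∑ j ∈ Finset.Icc 1 t, stepWeight H t j / j ≤ (1 + 1 / H) / t := by
  have hH' : (0 : ℝ) < H := by exact_mod_cast hH
  induction t, ht using Nat.le_induction with
  | base =>
    simp only [Finset.Icc_self, Finset.sum_singleton, stepWeight_self le_rfl]
    have := stepSize_le_one H 1 le_rfl
    have : (0 : ℝ) < 1 / H := by positivity
    rw [Nat.cast_one, div_one, div_one]
    linarith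
  | succ t ht ih =>
    have ht' : (0 : ℝ) < t := by exact_mod_cast ht
    rw [Finset.sum_Icc_succ_top (by omega), stepWeight_self (by omega)]
    have h1 := one_sub_stepSize H (t + 1) (by omega)
    push_cast at h1
    rw [add_sub_cancel_right] at h1
    have e : ∑ j ∈ Finset.Icc 1 t, stepWeight H (t + 1) j / j =
        (t / (H + (t + 1))) * ∑ j ∈ Finset.Icc 1 t, stepWeight H t j / j := by
      rw [Finset.mul_sum]
      refine Finset.sum_congr rfl fun j hj => ?_
      rw [stepWeight_succ (Finset.mem_Icc.1 hj).2, h1]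
      ring
    rw [e]
    calc (t / (H + (t + 1) : ℝ)) * ∑ j ∈ Finset.Icc 1 t, stepWeight H t j / j +
          stepSize H (t + 1) / ((t + 1 : ℕ) : ℝ) ≤
        (t / (H + (t + 1) : ℝ)) * ((1 + 1 / H) / t) + stepSize H (t + 1) / ((t + 1 : ℕ) : ℝ) := by
          gcongr
      _ = (1 + 1 / H) / ((t + 1 : ℕ) : ℝ) := by
        rw [stepSize]
        push_cast
        field_simp
        ring

end Weights

/-! ### Regret of optimistic FTRL with the log-barrier. -/

section OFTRL

variable {X : Type*} [Fintype X]

/-- Regret bound for optimistic follow-the-regularized-leader with the log-barrier and regularizer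
weights `w t / η`, where `g` are the gains, `m` the predictions and `x` the iterates. -/
theorem oftrl_regret_le {η : ℝ} (hη : 0 < η) {w : ℕ → ℝ} (hw : ∀ t, 1 ≤ t → 0 < w t)
    (hmono : ∀ t, 1 ≤ t → w t ≤ w (t + 1)) {g m x : ℕ → X → ℝ} {τ : ℕ} (hτ : 1 ≤ τ)
    (hx : ∀ t, 1 ≤ t → t ≤ τ → x t ∈ barrierDomain X)
    (hmax : ∀ t, 1 ≤ t → t ≤ τ → IsMaxOn (fun y : X → ℝ =>
      ∑ b, y b * (η * (∑ j ∈ Finset.Ico 1 t, g j b + m t b) / w t) - logBarrier y)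
      (barrierDomain X) (x t))
    {y : X → ℝ} (hy : y ∈ barrierDomain X) :
    ∑ j ∈ Finset.Icc 1 τ, ∑ b, (y b - x j b) * g j b ≤
      w τ / η * (logBarrier y - Fintype.card X * Real.log (Fintype.card X))
        + ∑ b, (y b - x τ b) * (g τ b - m τ b)
        + ∑ t ∈ Finset.Ico 1 τ, (∑ b, (x (t + 1) b - x t b) * (g t b - m t b)
          - w t / η * barrierDiv (x (t + 1)) (x t)) := by
  set R₀ : ℝ := Fintype.card X * Real.log (Fintype.card X) with hR
  let L : ℕ → X → ℝ := fun t b => ∑ j ∈ Finset.Ico 1 t, g j b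
  have fact : ∀ t, 1 ≤ t → t ≤ τ → ∀ z ∈ barrierDomain X,
      ∑ b, z b * L t b + ∑ b, z b * m t b - w t / η * logBarrier z
        + w t / η * barrierDiv z (x t) =
      ∑ b, x t b * L t b + ∑ b, x t b * m t b - w t / η * logBarrier (x t) := by
    intro t h1 h2 z hz
    have h := objective_add_barrierDiv (hx t h1 h2) (hmax t h1 h2) hz
    have hwt := (hw t h1).ne'
    have e : ∀ v : X → ℝ, ∑ b, v b * (η * (∑ j ∈ Finset.Ico 1 t, g j b + m t b) / w t) =
        η / w t * (∑ b, v b * L t b + ∑ b, v b * m t b) := fun v => by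
      rw [← Finset.sum_add_distrib, Finset.mul_sum]
      exact Finset.sum_congr rfl fun b _ => by simp only [L]; ring
    rw [e, e] at h
    have h3 := congrArg (fun r => w t / η * r) h
    simp only [mul_add, mul_sub] at h3
    have e2 : ∀ r : ℝ, w t / η * (η / w t * r) = r := fun r => by field_simp
    simp only [← mul_assoc] at h3
    have e3 : w t / η * (η / w t) = 1 := by field_simp
    simp only [e3, one_mul] at h3
    linarith
  -- `R₀` is the minimum of the barrier on the simplex; once it is subtracted, raising the weight
  -- from `w t` to `w (t + 1)` can only increase the regularization term.
  let Φ : ℕ → ℝ := fun t => w t / η * (logBarrier (x t) - R₀) - ∑ b, x t b * L t b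
  have hΦ : ∀ t, 1 ≤ t → t ≤ τ → ∑ j ∈ Finset.Ico 1 t, (w j / η * barrierDiv (x (j + 1)) (x j)
      - ∑ b, x j b * g j b - ∑ b, (x (j + 1) b - x j b) * (g j b - m j b)) ≤ Φ t := by
    intro t ht
    induction t, ht using Nat.le_induction with
    | base =>
      intro h
      simp only [Finset.Ico_self, Finset.sum_empty, Φ, L, mul_zero, Finset.sum_const_zero,
        sub_zero]
      exact mul_nonneg (div_pos (hw 1 le_rfl) hη).le
        (sub_nonneg.2 (card_mul_log_le_logBarrier (hx 1 le_rfl h)))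
    | succ t ht ih =>
      intro h
      rw [Finset.sum_Ico_succ_top ht]
      have h1 := ih (by omega)
      have h2 := fact t ht (by omega) (x (t + 1)) (hx (t + 1) (by omega) h)
      have h3 : w t / η * (logBarrier (x (t + 1)) - R₀) ≤
          w (t + 1) / η * (logBarrier (x (t + 1)) - R₀) := by
        refine mul_le_mul_of_nonneg_right ?_
          (sub_nonneg.2 (card_mul_log_le_logBarrier (hx (t + 1) (by omega) h)))
        exact div_le_div_of_nonneg_right (hmono t ht) hη.le
      have h4 : ∑ b, x (t + 1) b * L (t + 1) b =
          ∑ b, x (t + 1) b * L t b + ∑ b, x (t + 1) b * g t b := by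
        rw [← Finset.sum_add_distrib]
        exact Finset.sum_congr rfl fun b _ => by
          simp only [L]; rw [Finset.sum_Ico_succ_top ht]; ring
      have h5 : ∑ b, (x (t + 1) b - x t b) * (g t b - m t b) =
          ∑ b, x (t + 1) b * g t b - ∑ b, x t b * g t b - ∑ b, x (t + 1) b * m t b
            + ∑ b, x t b * m t b := by
        simp only [← Finset.sum_add_distrib, ← Finset.sum_sub_distrib]
        exact Finset.sum_congr rfl fun b _ => by ring
      simp only [Φ] at h1 ⊢
      rw [h4, h5]
      linarith
  have h1 := hΦ τ hτ le_rfl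
  have h2 := fact τ hτ le_rfl y hy
  have h3 : 0 ≤ w τ / η * barrierDiv y (x τ) := mul_nonneg (div_pos (hw τ hτ) hη).le
    (barrierDiv_nonneg (hx τ hτ le_rfl).2 hy.2)
  have h4 : ∑ j ∈ Finset.Icc 1 τ, ∑ b, (y b - x j b) * g j b =
      ∑ b, y b * L τ b + ∑ b, y b * g τ b - ∑ j ∈ Finset.Ico 1 τ, ∑ b, x j b * g j b
        - ∑ b, x τ b * g τ b := by
    have e1 : ∑ b, y b * L τ b = ∑ j ∈ Finset.Ico 1 τ, ∑ b, y b * g j b := by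
      rw [Finset.sum_comm]
      exact Finset.sum_congr rfl fun b _ => by rw [Finset.mul_sum]
    rw [← Finset.Ico_insert_right hτ, Finset.sum_insert (by simp), e1]
    simp only [sub_mul, Finset.sum_sub_distrib]
    ring
  have h5 : ∑ b, (y b - x τ b) * (g τ b - m τ b) =
      ∑ b, y b * g τ b - ∑ b, x τ b * g τ b - ∑ b, y b * m τ b + ∑ b, x τ b * m τ b := by
    simp only [← Finset.sum_add_distrib, ← Finset.sum_sub_distrib]
    exact Finset.sum_congr rfl fun b _ => by ring
  simp only [Finset.sum_sub_distrib, Φ] at h1 ⊢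
  rw [h4, h5]
  linarith

end OFTRL

/-! ### Swap regret of a single agent at a fixed step and state. -/

section SwapLearner

variable {X : Type*} [Fintype X]

/-- One agent at a fixed step and state running BM-OFTRL against utilities `u`: `p` are the
policies and `q t c` is the output of the base algorithm of action `c`. -/
structure IsSwapLearner (H : ℕ) (η : ℝ) (T : ℕ) (p u : ℕ → X → ℝ) (q : ℕ → X → X → ℝ) : Prop where
  policy_mem : ∀ t, t ≤ T → p t ∈ stdSimplex ℝ X
  utility_mem : ∀ t, t ≤ T → ∀ b, u t b ∈ Set.Icc (0 : ℝ) H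
  utility_zero : ∀ b, u 0 b = 0
  policy_zero : ∀ b, p 0 b = 1 / (Fintype.card X : ℝ)
  base_mem : ∀ t, 1 ≤ t → t ≤ T → ∀ c, q t c ∈ barrierDomain X
  base_max : ∀ t, 1 ≤ t → t ≤ T → ∀ c, IsMaxOn (fun y : X → ℝ => ∑ b, y b *
    (η * (∑ j ∈ Finset.Ico 1 t, oftrlWeight H j j * p j c * u j b
      + oftrlWeight H t t * p (t - 1) c * u (t - 1) b) / oftrlWeight H t t) - logBarrier y)
    (barrierDomain X) (q t c)
  stationary : ∀ t, 1 ≤ t → t ≤ T → ∀ b, p t b = ∑ c, p t c * q t c b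

namespace IsSwapLearner

variable {H T : ℕ} {η : ℝ} {p u : ℕ → X → ℝ} {q : ℕ → X → X → ℝ}

theorem isStationary (h : IsSwapLearner H η T p u q) {t : ℕ} (h1 : 1 ≤ t) (h2 : t ≤ T) :
    IsStationary (q t) (p t) := ⟨h.policy_mem t h2, h.stationary t h1 h2⟩

/-- The first prediction vanishes because `u 0` does, so every base output is uniform. Hence there
is no movement at t = 1, which the index shift in `swapRegret_joint_le` uses. -/
theorem policy_one (h : IsSwapLearner H η T p u q) (hT : 1 ≤ T) (b : X) : p 1 b = p 0 b := by
  have hq : ∀ c b, q 1 c b = 1 / (Fintype.card X : ℝ) := fun c b => by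
    have h1 := h.base_max 1 le_rfl hT c
    have h3 : ∀ a, q 1 c a = q 1 c b := fun a => by
      have h2 := add_inv_eq_of_isMaxOn (h.base_mem 1 le_rfl hT c) h1 a b
      simpa [h.utility_zero] using h2
    have h4 := (h.base_mem 1 le_rfl hT c).1.2
    rw [Finset.sum_congr rfl fun a _ => h3 a, Finset.sum_const, Finset.card_univ,
      nsmul_eq_mul] at h4
    have : (Fintype.card X : ℝ) ≠ 0 := fun h0 => by simp [h0] at h4
    field_simp
    linarith
  rw [h.stationary 1 le_rfl hT b, h.policy_zero b, Finset.sum_congr rfl fun c _ => by rw [hq c b],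
    ← Finset.sum_mul, (h.policy_mem 1 hT).2, one_mul]

/-- Multiplicative stability of the base algorithms. -/
theorem exists_base_stable (h : IsSwapLearner H η T p u q) (hη : 0 < η)
    (hηH : η * H ≤ 1 / 256) {t : ℕ} (ht : 1 ≤ t) (htT : t + 1 ≤ T) :
    ∃ M : X → ℝ, (∑ c, M c ≤ 1 / 32) ∧
      ∀ c b, |q (t + 1) c b / q t c b - 1| ≤ M c := by
  set w : ℕ → ℝ := fun t => oftrlWeight H t t with hw
  have hwt : 0 < w t := oftrlWeight_pos ht
  have hwt' : 0 < w (t + 1) := oftrlWeight_pos (by omega)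
  have hle : w t ≤ w (t + 1) := oftrlWeight_le_succ ht
  have hinv : 0 ≤ (w t)⁻¹ - (w (t + 1))⁻¹ := sub_nonneg.2 (inv_anti₀ hwt hle)
  -- The terms account for the rescaled past, the gain and new prediction of round `t`, and the
  -- dropped prediction. Each is proportional to probabilities of `c`, so the sum over `c` is at
  -- most 4ηH, with no factor for the number of actions.
  let M : X → ℝ := fun c => η * H * ((∑ j ∈ Finset.Ico 1 t, w j * p j c) *
    ((w t)⁻¹ - (w (t + 1))⁻¹) + 2 * p t c + p (t - 1) c)
  refine ⟨fun c => 2 * M c, ?_, fun c b => ?_⟩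
  · have e : ∑ c, M c ≤ η * H * 4 := by
      simp only [M]
      rw [← Finset.mul_sum]
      refine mul_le_mul_of_nonneg_left ?_ (by positivity)
      have e1 : ∑ c, ∑ j ∈ Finset.Ico 1 t, w j * p j c = ∑ j ∈ Finset.Ico 1 t, w j := by
        rw [Finset.sum_comm]
        refine Finset.sum_congr rfl fun j hj => ?_
        rw [← Finset.mul_sum, (h.policy_mem j (by have := (Finset.mem_Ico.1 hj).2; omega)).2,
          mul_one]
      rw [Finset.sum_add_distrib, Finset.sum_add_distrib, ← Finset.sum_mul, ← Finset.mul_sum, e1,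
        (h.policy_mem t (by omega)).2, (h.policy_mem (t - 1) (by omega)).2]
      have := sum_oftrlWeight_mul_le (H := H) ht
      simp only [hw]
      linarith
    rw [← Finset.mul_sum]
    linarith
  · refine abs_div_sub_one_le (h.base_mem t ht (by omega) c) (h.base_max t ht (by omega) c)
      (h.base_mem (t + 1) (by omega) htT c) (h.base_max (t + 1) (by omega) htT c) (fun b => ?_) b
    simp only [Nat.add_sub_cancel]
    rw [Finset.sum_Ico_succ_top ht]
    change |η * (∑ j ∈ Finset.Ico 1 t, w j * p j c * u j b + w t * p t c * u t b +
      w (t + 1) * p t c * u t b) / w (t + 1) - η * (∑ j ∈ Finset.Ico 1 t, w j * p j c * u j b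
        + w t * p (t - 1) c * u (t - 1) b) / w t| ≤ M c
    set S := ∑ j ∈ Finset.Ico 1 t, w j * p j c * u j b with hS
    set S' := ∑ j ∈ Finset.Ico 1 t, w j * p j c with hS'
    have hwj : ∀ j ∈ Finset.Ico 1 t, 0 ≤ w j * p j c ∧ j ≤ T := fun j hj => by
      obtain ⟨h1, h2⟩ := Finset.mem_Ico.1 hj
      exact ⟨mul_nonneg (oftrlWeight_pos h1).le ((h.policy_mem j (by omega)).1 c), by omega⟩
    have hS0 : 0 ≤ S := Finset.sum_nonneg fun j hj =>
      mul_nonneg (hwj j hj).1 (h.utility_mem j (hwj j hj).2 b).1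
    have hSS : S ≤ S' * H := by
      rw [hS, hS', Finset.sum_mul]
      exact Finset.sum_le_sum fun j hj =>
        mul_le_mul_of_nonneg_left (h.utility_mem j (hwj j hj).2 b).2 (hwj j hj).1
    have e : η * (S + w t * p t c * u t b + w (t + 1) * p t c * u t b) / w (t + 1) -
        η * (S + w t * p (t - 1) c * u (t - 1) b) / w t =
        η * (-(S * ((w t)⁻¹ - (w (t + 1))⁻¹)) + w t / w (t + 1) * (p t c * u t b) + p t c * u t b
          - p (t - 1) c * u (t - 1) b) := by
      field_simp
      ring
    rw [e, abs_mul, abs_of_pos hη]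
    simp only [M]
    rw [mul_assoc η]
    refine mul_le_mul_of_nonneg_left ?_ hη.le
    have hpu : ∀ s, s ≤ T → 0 ≤ p s c * u s b ∧ p s c * u s b ≤ p s c * H := fun s hs =>
      ⟨mul_nonneg ((h.policy_mem s hs).1 c) (h.utility_mem s hs b).1,
        mul_le_mul_of_nonneg_left (h.utility_mem s hs b).2 ((h.policy_mem s hs).1 c)⟩
    obtain ⟨a1, a2⟩ := hpu t (by omega)
    obtain ⟨a3, a4⟩ := hpu (t - 1) (by omega)
    have hr : w t / w (t + 1) ≤ 1 := (div_le_one hwt').2 hle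
    have hr0 : 0 ≤ w t / w (t + 1) := by positivity
    have a5 : 0 ≤ w t / w (t + 1) * (p t c * u t b) := mul_nonneg hr0 a1
    have a6 : w t / w (t + 1) * (p t c * u t b) ≤ p t c * u t b := mul_le_of_le_one_left a1 hr
    have a7 : 0 ≤ S * ((w t)⁻¹ - (w (t + 1))⁻¹) := mul_nonneg hS0 hinv
    have a8 : S * ((w t)⁻¹ - (w (t + 1))⁻¹) ≤ S' * H * ((w t)⁻¹ - (w (t + 1))⁻¹) :=
      mul_le_mul_of_nonneg_right hSS hinv
    rw [abs_le]
    constructor <;> linarith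

/-- The policy moves by at most the relative movement of the base algorithms. -/
theorem sq_sum_abs_sub_le (h : IsSwapLearner H η T p u q) (hη : 0 < η)
    (hηH : η * H ≤ 1 / 256) {t : ℕ} (ht : 1 ≤ t) (htT : t + 1 ≤ T) :
    (∑ b, |p (t + 1) b - p t b|) ^ 2 ≤
      64 * Fintype.card X * ∑ c, ∑ b, (q (t + 1) c b / q t c b - 1) ^ 2 := by
  obtain ⟨M, hM, hMz⟩ := h.exists_base_stable hη hηH ht htT
  -- `M` only certifies smallness. The bound itself uses the largest actual relative movement in
  -- each row, so that Cauchy–Schwarz can compare it with the sum of squares.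
  have hex : ∀ c : X, ∃ b, ∀ a, |q (t + 1) c a / q t c a - 1| ≤ |q (t + 1) c b / q t c b - 1| :=
    fun c => by
      obtain ⟨b, -, hb⟩ := Finset.exists_max_image Finset.univ
        (fun b => |q (t + 1) c b / q t c b - 1|) ⟨c, Finset.mem_univ c⟩
      exact ⟨b, fun a => hb a (Finset.mem_univ a)⟩
  choose β hβ using hex
  set ε : X → ℝ := fun c => |q (t + 1) c (β c) / q t c (β c) - 1| with hε
  have hsum : ∑ c, ε c ≤ 1 / 4 :=
    (Finset.sum_le_sum fun c _ => hMz c (β c)).trans (by linarith)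
  have h1 := IsStationary.sum_abs_sub_le (fun c => h.base_mem t ht (by omega) c)
    (fun c => h.base_mem (t + 1) (by omega) htT c) (h.isStationary ht (by omega))
    (h.isStationary (by omega) htT) hβ hsum
  have h0 : 0 ≤ ∑ b, |p (t + 1) b - p t b| := Finset.sum_nonneg fun b _ => abs_nonneg _
  calc (∑ b, |p (t + 1) b - p t b|) ^ 2 ≤ (8 * ∑ c, ε c) ^ 2 := pow_le_pow_left₀ h0 h1 2
    _ = 64 * (∑ c, ε c) ^ 2 := by ring
    _ ≤ 64 * (Fintype.card X * ∑ c, ε c ^ 2) := by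
      gcongr
      exact sq_sum_le_card_mul_sum_sq
    _ ≤ 64 * (Fintype.card X * ∑ c, ∑ b, (q (t + 1) c b / q t c b - 1) ^ 2) := by
      gcongr with c
      rw [hε, sq_abs]
      exact Finset.single_le_sum (f := fun b => (q (t + 1) c b / q t c b - 1) ^ 2)
        (fun b _ => sq_nonneg _) (Finset.mem_univ (β c))
    _ = _ := by ring

theorem sq_le_one_of_mem_simplex {x : X → ℝ} (hx : x ∈ stdSimplex ℝ X) : ∑ b, x b ^ 2 ≤ 1 := by
  rw [← hx.2]
  refine Finset.sum_le_sum fun b _ => ?_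
  have : x b ≤ 1 := by
    rw [← hx.2]
    exact Finset.single_le_sum (fun c _ => hx.1 c) (Finset.mem_univ b)
  nlinarith [hx.1 b]

/-- Stability term of one base algorithm. -/
theorem stability_le {x x' v : X → ℝ} (hx : x ∈ barrierDomain X) (hη : 0 < η)
    (hz : ∀ b, |x' b / x b - 1| ≤ 1 / 5) {ν : ℝ} (hv : ∀ b, |v b| ≤ ν) :
    ∑ b, (x' b - x b) * v b - 1 / η * barrierDiv x' x ≤
      2 * η * ν ^ 2 - (∑ b, (x' b / x b - 1) ^ 2) / (8 * η) := by
  have h1 := sq_sum_le_barrierDiv hz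
  have h2 : ∑ b, (x' b - x b) * v b ≤
      ∑ b, ((x' b / x b - 1) ^ 2 / (8 * η) + 2 * η * ν ^ 2 * x b ^ 2) := by
    refine Finset.sum_le_sum fun b _ => ?_
    have hxb := hx.2 b
    have e : (x' b - x b) * v b = (x' b / x b - 1) * (x b * v b) := by field_simp
    rw [e]
    set z := x' b / x b - 1
    have h3 : v b ^ 2 ≤ ν ^ 2 := sq_le_sq' (by linarith [(abs_le.1 (hv b)).1]) (abs_le.1 (hv b)).2
    -- The divergence supplies z²/(4η); half of it pays for this term and the other half survives as
    -- the negative term.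
    have h4 : z * (x b * v b) ≤ z ^ 2 / (8 * η) + 2 * η * (x b * v b) ^ 2 := by
      rw [div_add' _ _ _ (by positivity), le_div_iff₀ (by positivity)]
      nlinarith [sq_nonneg (z - 4 * η * (x b * v b))]
    have h5 : 2 * η * (x b * v b) ^ 2 ≤ 2 * η * ν ^ 2 * x b ^ 2 := by
      rw [mul_pow]
      calc 2 * η * (x b ^ 2 * v b ^ 2) ≤ 2 * η * (x b ^ 2 * ν ^ 2) := by gcongr
        _ = _ := by ring
    linarith
  rw [Finset.sum_add_distrib, ← Finset.sum_div, ← Finset.mul_sum] at h2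
  have h6 : 2 * η * ν ^ 2 * ∑ b, x b ^ 2 ≤ 2 * η * ν ^ 2 :=
    mul_le_of_le_one_right (by positivity) (sq_le_one_of_mem_simplex hx.1)
  have h7 : 1 / η * ((∑ b, (x' b / x b - 1) ^ 2) / 4) ≤ 1 / η * barrierDiv x' x := by gcongr
  have e : 1 / η * ((∑ b, (x' b / x b - 1) ^ 2) / 4) =
      2 * ((∑ b, (x' b / x b - 1) ^ 2) / (8 * η)) := by
    field_simp
    ring
  linarith

/-- The vertex `a` of the simplex mixed with the uniform distribution. -/
theorem exists_smoothed_vertex (a : X) {T : ℕ} (hT : 1 ≤ T) :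
    ∃ y ∈ barrierDomain X,
      logBarrier y - Fintype.card X * Real.log (Fintype.card X) ≤ Fintype.card X * Real.log T ∧
      ∀ (B : ℝ) (v : X → ℝ), (∀ b, v b ∈ Set.Icc 0 B) → v a - B / T ≤ ∑ b, y b * v b := by
  classical
  have hT' : (1 : ℝ) ≤ T := by exact_mod_cast hT
  have hT0 : (0 : ℝ) < T := by linarith
  have hn : (0 : ℝ) < Fintype.card X := by exact_mod_cast Fintype.card_pos_iff.2 ⟨a⟩
  have h1T : (1 : ℝ) / T ≤ 1 := (div_le_one hT0).2 hT'
  -- Every coordinate is at least 1/(T card), so the barrier exceeds its minimum by at most card *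
  -- log T, while the uniform part loses only B/T.
  let y : X → ℝ := fun b => (1 - 1 / T) * (if b = a then 1 else 0) + 1 / (T * Fintype.card X)
  have hyl : ∀ b, 1 / (T * Fintype.card X : ℝ) ≤ y b := fun b => by
    have : 0 ≤ (1 - 1 / (T : ℝ)) * (if b = a then 1 else 0) :=
      mul_nonneg (by linarith) (by split_ifs <;> norm_num)
    simp only [y]
    linarith
  have hpos : ∀ b, 0 < y b := fun b => lt_of_lt_of_le (by positivity) (hyl b)
  refine ⟨y, ⟨⟨fun b => (hpos b).le, ?_⟩, hpos⟩, ?_, fun B v hv => ?_⟩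
  · simp only [y, Finset.sum_add_distrib, ← Finset.mul_sum, Finset.sum_ite_eq', Finset.mem_univ,
      if_true, Finset.sum_const, Finset.card_univ, nsmul_eq_mul]
    field_simp
    ring
  · have h1 : ∀ b, -Real.log (y b) ≤ Real.log T + Real.log (Fintype.card X) := fun b => by
      have := Real.log_le_log (by positivity) (hyl b)
      rw [one_div, Real.log_inv, Real.log_mul hT0.ne' hn.ne'] at this
      linarith
    have h2 := Finset.sum_le_sum fun b (_ : b ∈ Finset.univ) => h1 b
    rw [Finset.sum_neg_distrib, Finset.sum_const, Finset.card_univ, nsmul_eq_mul] at h2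
    simp only [logBarrier]
    linarith
  · have e : ∑ b, y b * v b = (1 - 1 / T) * v a + 1 / (T * Fintype.card X) * ∑ b, v b := by
      simp only [y, add_mul, Finset.sum_add_distrib, Finset.mul_sum, mul_assoc, ite_mul, one_mul,
        zero_mul, mul_ite, mul_zero, Finset.sum_ite_eq', Finset.mem_univ, if_true]
    have h1 : 0 ≤ 1 / (T * Fintype.card X : ℝ) * ∑ b, v b :=
      mul_nonneg (by positivity) (Finset.sum_nonneg fun b _ => (hv b).1)
    have h2 : 1 / (T : ℝ) * v a ≤ 1 / T * B := by gcongr; exact (hv a).2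
    rw [e]
    have e2 : B / T = 1 / T * B := by ring
    rw [e2]
    linarith

/-- Weighted swap regret bound in terms of the movement of policies and utilities. -/
theorem swapRegret_le (h : IsSwapLearner H η T p u q) (hη : 0 < η)
    (hηH : η * H ≤ 1 / 256) (φ : X → X) {τ : ℕ} (hτ : 1 ≤ τ) (hτT : τ ≤ T) {e : ℕ → ℝ}
    (he : ∀ t, 1 ≤ t → t ≤ T → ∀ b, |u t b - u (t - 1) b| ≤ e t) :
    ∑ j ∈ Finset.Icc 1 τ, oftrlWeight H j j * ∑ c, p j c * (u j (φ c) - u j c) ≤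
      oftrlWeight H τ τ / η * ((Fintype.card X : ℝ) ^ 2 * Real.log T) + 2 * H * oftrlWeight H τ τ
        + H / T * ∑ j ∈ Finset.Icc 1 τ, oftrlWeight H j j
        + ∑ t ∈ Finset.Ico 1 τ, oftrlWeight H t t *
          (4 * η * (H ^ 2 * (∑ b, |p t b - p (t - 1) b|) ^ 2 + e t ^ 2)
            - (∑ b, |p (t + 1) b - p t b|) ^ 2 / (512 * Fintype.card X * η)) := by
  classical
  have hH0 : (0 : ℝ) ≤ H := by positivity
  set w : ℕ → ℝ := fun t => oftrlWeight H t t with hw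
  have hwp : ∀ t, 1 ≤ t → 0 < w t := fun t ht => oftrlWeight_pos ht
  choose y hyd hyl hyv using fun c => exists_smoothed_vertex (φ c) (hτ.trans hτT)
  have hreg := fun c => oftrl_regret_le hη hwp (fun t ht => oftrlWeight_le_succ ht)
    (g := fun t b => w t * p t c * u t b) (m := fun t b => w t * p (t - 1) c * u (t - 1) b)
    (x := fun t => q t c) hτ (fun t h1 h2 => h.base_mem t h1 (h2.trans hτT) c)
    (fun t h1 h2 => h.base_max t h1 (h2.trans hτT) c) (hyd c)
  have hlow : ∑ j ∈ Finset.Icc 1 τ, w j * ∑ c, p j c * (u j (φ c) - u j c) -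
      H / T * ∑ j ∈ Finset.Icc 1 τ, w j ≤
      ∑ c, ∑ j ∈ Finset.Icc 1 τ, ∑ b, (y c b - q j c b) * (w j * p j c * u j b) := by
    rw [Finset.sum_comm, Finset.mul_sum, ← Finset.sum_sub_distrib]
    refine Finset.sum_le_sum fun j hj => ?_
    obtain ⟨hj1, hj2⟩ := Finset.mem_Icc.1 hj
    have hjT := hj2.trans hτT
    -- Blum–Mansour identity: by stationarity the agent's own payoff is the `p`-weighted payoff of
    -- the base outputs.
    have e1 : ∑ c, p j c * u j c = ∑ c, p j c * ∑ b, q j c b * u j b := by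
      simp only [Finset.mul_sum]
      rw [Finset.sum_comm]
      refine Finset.sum_congr rfl fun b _ => ?_
      rw [h.stationary j hj1 hjT b, Finset.sum_mul]
      exact Finset.sum_congr rfl fun c _ => by ring
    have e2 : ∑ c, ∑ b, (y c b - q j c b) * (w j * p j c * u j b) =
        w j * (∑ c, p j c * ∑ b, y c b * u j b - ∑ c, p j c * u j c) := by
      rw [e1, ← Finset.sum_sub_distrib, Finset.mul_sum]
      refine Finset.sum_congr rfl fun c _ => ?_
      rw [← mul_sub, ← Finset.sum_sub_distrib, Finset.mul_sum, Finset.mul_sum]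
      exact Finset.sum_congr rfl fun b _ => by ring
    have e3 : ∑ c, p j c * (u j (φ c) - H / T) ≤ ∑ c, p j c * ∑ b, y c b * u j b :=
      Finset.sum_le_sum fun c _ => mul_le_mul_of_nonneg_left
        (hyv c H (u j) (h.utility_mem j hjT)) ((h.policy_mem j hjT).1 c)
    have e4 : ∑ c, p j c * (u j (φ c) - H / T) = ∑ c, p j c * u j (φ c) - H / T := by
      simp only [mul_sub, Finset.sum_sub_distrib]
      rw [← Finset.sum_mul, (h.policy_mem j hjT).2, one_mul]
    rw [e2]
    simp only [mul_sub, Finset.sum_sub_distrib]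
    have := mul_le_mul_of_nonneg_left e3 (hwp j hj1).le
    rw [e4] at this
    linarith
  have hA : ∑ c, w τ / η * (logBarrier (y c) - Fintype.card X * Real.log (Fintype.card X)) ≤
      w τ / η * ((Fintype.card X : ℝ) ^ 2 * Real.log T) := by
    calc _ ≤ ∑ _c : X, w τ / η * (Fintype.card X * Real.log T) :=
          Finset.sum_le_sum fun c _ =>
            mul_le_mul_of_nonneg_left (hyl c) (div_pos (hwp τ hτ) hη).le
      _ = _ := by
        rw [Finset.sum_const, Finset.card_univ, nsmul_eq_mul]
        ring
  have hB : ∑ c, ∑ b, (y c b - q τ c b) *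
      (w τ * p τ c * u τ b - w τ * p (τ - 1) c * u (τ - 1) b) ≤ 2 * H * w τ := by
    have hav : ∀ x ∈ stdSimplex ℝ X, ∀ s, s ≤ T →
        0 ≤ ∑ b, x b * u s b ∧ ∑ b, x b * u s b ≤ H := fun x hx s hs => by
      refine ⟨Finset.sum_nonneg fun b _ => mul_nonneg (hx.1 b) (h.utility_mem s hs b).1, ?_⟩
      calc ∑ b, x b * u s b ≤ ∑ b, x b * H := Finset.sum_le_sum fun b _ =>
            mul_le_mul_of_nonneg_left (h.utility_mem s hs b).2 (hx.1 b)
        _ = H := by rw [← Finset.sum_mul, hx.2, one_mul]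
    have hc : ∀ c, ∑ b, (y c b - q τ c b) *
        (w τ * p τ c * u τ b - w τ * p (τ - 1) c * u (τ - 1) b) ≤
        w τ * H * (p τ c + p (τ - 1) c) := fun c => by
      obtain ⟨a1, a2⟩ := hav (y c) (hyd c).1 τ hτT
      obtain ⟨a3, a4⟩ := hav (y c) (hyd c).1 (τ - 1) (by omega)
      obtain ⟨a5, a6⟩ := hav (q τ c) (h.base_mem τ hτ hτT c).1 τ hτT
      obtain ⟨a7, a8⟩ := hav (q τ c) (h.base_mem τ hτ hτT c).1 (τ - 1) (by omega)
      have b1 := mul_nonneg (hwp τ hτ).le ((h.policy_mem τ hτT).1 c)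
      have b2 := mul_nonneg (hwp τ hτ).le ((h.policy_mem (τ - 1) (by omega)).1 c)
      have e1 : ∑ b, (y c b - q τ c b) *
          (w τ * p τ c * u τ b - w τ * p (τ - 1) c * u (τ - 1) b) =
          w τ * p τ c * (∑ b, y c b * u τ b - ∑ b, q τ c b * u τ b) -
          w τ * p (τ - 1) c * (∑ b, y c b * u (τ - 1) b - ∑ b, q τ c b * u (τ - 1) b) := by
        simp only [← Finset.sum_sub_distrib, Finset.mul_sum]
        exact Finset.sum_congr rfl fun b _ => by ring
      rw [e1]
      have c1 := mul_le_mul_of_nonneg_left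
        (show ∑ b, y c b * u τ b - ∑ b, q τ c b * u τ b ≤ H by linarith) b1
      have c2 := mul_le_mul_of_nonneg_left
        (show -(H : ℝ) ≤ ∑ b, y c b * u (τ - 1) b - ∑ b, q τ c b * u (τ - 1) b by linarith) b2
      linarith
    refine (Finset.sum_le_sum fun c _ => hc c).trans ?_
    rw [← Finset.mul_sum, Finset.sum_add_distrib, (h.policy_mem τ hτT).2,
      (h.policy_mem (τ - 1) (by omega)).2]
    linarith
  have hC : ∀ t ∈ Finset.Ico 1 τ, ∑ c, (∑ b, (q (t + 1) c b - q t c b) *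
      (w t * p t c * u t b - w t * p (t - 1) c * u (t - 1) b)
        - w t / η * barrierDiv (q (t + 1) c) (q t c)) ≤
      w t * (4 * η * (H ^ 2 * (∑ b, |p t b - p (t - 1) b|) ^ 2 + e t ^ 2)
            - (∑ b, |p (t + 1) b - p t b|) ^ 2 / (512 * Fintype.card X * η)) := by
    intro t ht
    obtain ⟨ht1, ht2⟩ := Finset.mem_Ico.1 ht
    obtain ⟨M, hM, hMz⟩ := h.exists_base_stable hη hηH ht1 (show t + 1 ≤ T by omega)
    have hM0 : ∀ c, 0 ≤ M c := fun c => (abs_nonneg _).trans (hMz c c)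
    -- The change of p(c) u(b) splits into policy movement and utility movement. The latter carries
    -- the weights p(c), whose squares sum to at most one, so no factor for the number of actions
    -- appears.
    let ν : X → ℝ := fun c => H * |p t c - p (t - 1) c| + p (t - 1) c * e t
    have hst : ∀ c, ∑ b, (q (t + 1) c b - q t c b) *
        (w t * p t c * u t b - w t * p (t - 1) c * u (t - 1) b)
        - w t / η * barrierDiv (q (t + 1) c) (q t c) ≤
        w t * (2 * η * ν c ^ 2 - (∑ b, (q (t + 1) c b / q t c b - 1) ^ 2) / (8 * η)) := fun c => by
      have h1 := stability_le (h.base_mem t ht1 (by omega) c) hη (x' := q (t + 1) c)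
        (fun b => (hMz c b).trans (by
          have := Finset.single_le_sum (fun c _ => hM0 c) (Finset.mem_univ c)
          linarith))
        (v := fun b => p t c * u t b - p (t - 1) c * u (t - 1) b) (ν := ν c) (fun b => by
          have e1 : p t c * u t b - p (t - 1) c * u (t - 1) b =
            u t b * (p t c - p (t - 1) c) + p (t - 1) c * (u t b - u (t - 1) b) := by ring
          rw [e1]
          refine (abs_add_le _ _).trans (add_le_add ?_ ?_)
          · rw [abs_mul, abs_of_nonneg (h.utility_mem t (by omega) b).1]
            exact mul_le_mul_of_nonneg_right (h.utility_mem t (by omega) b).2 (abs_nonneg _)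
          · have h3 := (h.policy_mem (t - 1) (by omega)).1 c
            rw [abs_mul, abs_of_nonneg h3]
            exact mul_le_mul_of_nonneg_left (he t ht1 (by omega) b) h3)
      have h2 := mul_le_mul_of_nonneg_left h1 (hwp t ht1).le
      refine le_trans (le_of_eq ?_) h2
      rw [mul_sub, Finset.mul_sum]
      congr 1
      · exact Finset.sum_congr rfl fun b _ => by ring
      · ring
    refine (Finset.sum_le_sum fun c _ => hst c).trans ?_
    rw [← Finset.mul_sum]
    refine mul_le_mul_of_nonneg_left ?_ (hwp t ht1).le
    rw [Finset.sum_sub_distrib, ← Finset.mul_sum, ← Finset.sum_div]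
    have hν : ∑ c, ν c ^ 2 ≤ 2 * (H ^ 2 * (∑ b, |p t b - p (t - 1) b|) ^ 2 + e t ^ 2) := by
      have h1 : ∀ c, ν c ^ 2 ≤ 2 * H ^ 2 * |p t c - p (t - 1) c| ^ 2 +
          2 * e t ^ 2 * p (t - 1) c ^ 2 := fun c => by
        simp only [ν]
        nlinarith [sq_nonneg (H * |p t c - p (t - 1) c| - p (t - 1) c * e t)]
      have h2 := Finset.sum_le_sum fun c (_ : c ∈ Finset.univ) => h1 c
      rw [Finset.sum_add_distrib, ← Finset.mul_sum, ← Finset.mul_sum] at h2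
      have h3 : ∑ c, |p t c - p (t - 1) c| ^ 2 ≤ (∑ b, |p t b - p (t - 1) b|) ^ 2 :=
        Finset.sum_sq_le_sq_sum_of_nonneg fun c _ => abs_nonneg _
      have h4 := sq_le_one_of_mem_simplex (h.policy_mem (t - 1) (by omega))
      have h5 := mul_le_mul_of_nonneg_left h3 (show (0 : ℝ) ≤ 2 * H ^ 2 by positivity)
      have h6 := mul_le_mul_of_nonneg_left h4 (show (0 : ℝ) ≤ 2 * e t ^ 2 by positivity)
      linarith
    have h1 := h.sq_sum_abs_sub_le hη hηH ht1 (show t + 1 ≤ T by omega)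
    have h2 : (∑ b, |p (t + 1) b - p t b|) ^ 2 / (512 * Fintype.card X * η) ≤
        (∑ c, ∑ b, (q (t + 1) c b / q t c b - 1) ^ 2) / (8 * η) := by
      refine div_le_of_le_mul₀ (by positivity) (by positivity) (h1.trans (le_of_eq ?_))
      field_simp
      ring
    have h3 := mul_le_mul_of_nonneg_left hν (show 0 ≤ 2 * η by positivity)
    linarith
  have hsum := Finset.sum_le_sum fun c (_ : c ∈ Finset.univ) => hreg c
  rw [Finset.sum_add_distrib, Finset.sum_add_distrib] at hsum
  rw [Finset.sum_comm (s := Finset.univ) (t := Finset.Ico 1 τ)] at hsum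
  have hC' := Finset.sum_le_sum hC
  linarith

end IsSwapLearner

end SwapLearner

/-! ### All agents together: bounding the total movement. -/

section JointLearning

variable {N H T : ℕ} {η : ℝ} {X : Fin N → Type*} [∀ i, Fintype (X i)]

/-- When all agents run the algorithm and utilities move with the policies, nonnegativity of the
sum of swap regrets bounds the movement of all policies. -/
theorem swapRegret_joint_le (hH : 1 ≤ H) (hη : 0 < η) {A : ℝ}
    (hη2 : η ^ 2 * (65536 * N ^ 2 * H ^ 3 * A) = 1) (hηH : η * H ≤ 1 / 256)
    (hA : ∀ i, (Fintype.card (X i) : ℝ) ≤ A) (hA1 : 1 ≤ A)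
    {p u : (i : Fin N) → ℕ → X i → ℝ} {q : (i : Fin N) → ℕ → X i → X i → ℝ}
    (h : ∀ i, IsSwapLearner H η T (p i) (u i) (q i))
    (hu : ∀ i t, 1 ≤ t → t ≤ T → ∀ b, |u i t b - u i (t - 1) b| ≤
      stepSize H t * H + H * ∑ k, ∑ b, |p k t b - p k (t - 1) b|)
    (i : Fin N) (φ : X i → X i) {τ : ℕ} (hτ : 1 ≤ τ) (hτT : τ ≤ T) :
    ∑ j ∈ Finset.Icc 1 τ, oftrlWeight H j j * ∑ c, p i j c * (u i j (φ c) - u i j c) ≤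
      5 / 4 * (oftrlWeight H τ τ / η * (A ^ 2 * Real.log T) + 2 * H * oftrlWeight H τ τ
        + H / T * ∑ j ∈ Finset.Icc 1 τ, oftrlWeight H j j
        + 8 * η * H ^ 2 * ∑ t ∈ Finset.Ico 1 τ, oftrlWeight H t t * stepSize H t ^ 2) := by
  have hN : (1 : ℝ) ≤ N := by exact_mod_cast i.pos
  have hH' : (1 : ℝ) ≤ H := by exact_mod_cast hH
  have hlog : 0 ≤ Real.log T := Real.log_natCast_nonneg T
  set w : ℕ → ℝ := fun t => oftrlWeight H t t with hw
  have hwp : ∀ t, 1 ≤ t → 0 < w t := fun t ht => oftrlWeight_pos ht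
  let D : Fin N → ℕ → ℝ := fun k t => ∑ b, |p k t b - p k (t - 1) b|
  let P : ℕ → ℝ := fun t => ∑ k, D k t ^ 2
  have hP0 : ∀ t, 0 ≤ P t := fun t => Finset.sum_nonneg fun k _ => sq_nonneg _
  have hP1 : P 1 = 0 := Finset.sum_eq_zero fun k _ => by
    have : D k 1 = 0 := Finset.sum_eq_zero fun b _ => by
      rw [(h k).policy_one (hτ.trans hτT) b]
      simp
    rw [this]
    norm_num
  have hDP : ∀ k t, D k t ^ 2 ≤ P t := fun k t =>
    Finset.single_le_sum (f := fun k => D k t ^ 2) (fun k _ => sq_nonneg _) (Finset.mem_univ k)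
  have hsq : ∀ t, (∑ k, D k t) ^ 2 ≤ N * P t := fun t => by
    have := sq_sum_le_card_mul_sum_sq (s := (Finset.univ : Finset (Fin N))) (f := fun k => D k t)
    simpa using this
  set S := ∑ t ∈ Finset.Ico 1 τ, w t * P t with hS
  set C := w τ / η * (A ^ 2 * Real.log T) + 2 * H * w τ
        + H / T * ∑ j ∈ Finset.Icc 1 τ, w j
        + 8 * η * H ^ 2 * ∑ t ∈ Finset.Ico 1 τ, w t * stepSize H t ^ 2 with hC
  have hreg : ∀ k (ψ : X k → X k),
      ∑ j ∈ Finset.Icc 1 τ, w j * ∑ c, p k j c * (u k j (ψ c) - u k j c) ≤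
      C + 12 * η * H ^ 2 * N * S
        - 1 / (512 * A * η) * ∑ t ∈ Finset.Ico 1 τ, w t * D k (t + 1) ^ 2 := by
    intro k ψ
    refine ((h k).swapRegret_le hη hηH ψ hτ hτT (hu k)).trans ?_
    have hn : Nonempty (X k) := by
      by_contra hne
      rw [not_nonempty_iff] at hne
      have := ((h k).policy_mem 0 (Nat.zero_le _)).2
      simp at this
    have hcard : (0 : ℝ) < Fintype.card (X k) := by exact_mod_cast Fintype.card_pos
    have h1 : w τ / η * ((Fintype.card (X k) : ℝ) ^ 2 * Real.log T) ≤
        w τ / η * (A ^ 2 * Real.log T) := by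
      have := hwp τ hτ
      have := hA k
      gcongr
    have h2 : ∑ t ∈ Finset.Ico 1 τ, w t *
          (4 * η * (H ^ 2 * D k t ^ 2 + (stepSize H t * H + H * ∑ k, D k t) ^ 2)
            - D k (t + 1) ^ 2 / (512 * Fintype.card (X k) * η)) ≤
        8 * η * H ^ 2 * ∑ t ∈ Finset.Ico 1 τ, w t * stepSize H t ^ 2
        + 12 * η * H ^ 2 * N * S
        - 1 / (512 * A * η) * ∑ t ∈ Finset.Ico 1 τ, w t * D k (t + 1) ^ 2 := by
      rw [hS, Finset.mul_sum, Finset.mul_sum, Finset.mul_sum, ← Finset.sum_add_distrib,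
        ← Finset.sum_sub_distrib]
      refine Finset.sum_le_sum fun t ht => ?_
      have hwt := hwp t (Finset.mem_Ico.1 ht).1
      have e1 : (stepSize H t * H + H * ∑ k, D k t) ^ 2 ≤
          2 * H ^ 2 * stepSize H t ^ 2 + 2 * H ^ 2 * (N * P t) := by
        have := mul_le_mul_of_nonneg_left (hsq t) (show (0 : ℝ) ≤ 2 * H ^ 2 by positivity)
        nlinarith [sq_nonneg (stepSize H t * H - H * ∑ k, D k t)]
      have e2 : (H : ℝ) ^ 2 * D k t ^ 2 ≤ H ^ 2 * (N * P t) :=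
        mul_le_mul_of_nonneg_left ((hDP k t).trans (le_mul_of_one_le_left (hP0 t) hN))
          (by positivity)
      have e3 : 1 / (512 * A * η) * D k (t + 1) ^ 2 ≤
          D k (t + 1) ^ 2 / (512 * Fintype.card (X k) * η) := by
        rw [one_div_mul_eq_div]
        have := hA k
        gcongr
      have e4 : 4 * η * (H ^ 2 * D k t ^ 2 + (stepSize H t * H + H * ∑ k, D k t) ^ 2) ≤
          4 * η * (2 * H ^ 2 * stepSize H t ^ 2 + 3 * H ^ 2 * (N * P t)) := by
        refine mul_le_mul_of_nonneg_left ?_ (by positivity)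
        linarith
      calc _ ≤ w t * (4 * η * (2 * H ^ 2 * stepSize H t ^ 2 + 3 * H ^ 2 * (N * P t))
            - 1 / (512 * A * η) * D k (t + 1) ^ 2) :=
            mul_le_mul_of_nonneg_left (sub_le_sub e4 e3) hwt.le
        _ = _ := by ring
    simp only [D] at h2
    rw [hC]
    simp only [hw] at h1 h2 ⊢
    simp only [D, Nat.add_sub_cancel] at h2 ⊢
    linarith
  -- Index shift, possible because P 1 = 0 and w (t + 1) ≤ 2 H w t. The extra term `w τ * P τ` lets
  -- the induction close.
  have hSS : S + w τ * P τ ≤ 2 * H * ∑ t ∈ Finset.Ico 1 τ, w t * P (t + 1) := by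
    rw [hS]
    clear_value S
    clear hreg hC C hS hτT
    induction τ, hτ using Nat.le_induction with
    | base => simp [hP1]
    | succ t ht ih =>
      rw [Finset.sum_Ico_succ_top ht, Finset.sum_Ico_succ_top ht]
      have := mul_le_mul_of_nonneg_right (oftrlWeight_succ_le hH ht) (hP0 (t + 1))
      simp only [hw] at ih ⊢
      linarith
  have hwP : 0 ≤ w τ * P τ := mul_nonneg (hwp τ hτ).le (hP0 τ)
  -- The identity modification has zero regret, so each agent's upper bound is nonnegative; these
  -- bounds are summed over agents.
  have hsum : 0 ≤ N * C + N * (12 * η * H ^ 2 * N * S)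
      - 1 / (512 * A * η) * ∑ t ∈ Finset.Ico 1 τ, w t * P (t + 1) := by
    have h1 := Finset.sum_le_sum fun k (_ : k ∈ Finset.univ) => hreg k id
    simp only [id, sub_self, mul_zero, Finset.sum_const_zero, Finset.sum_sub_distrib,
      Finset.sum_const, Finset.card_univ, Fintype.card_fin, nsmul_eq_mul, ← Finset.mul_sum] at h1
    rw [Finset.sum_comm] at h1
    simp only [← Finset.mul_sum] at h1
    linarith
  have hη2' : 12 * η * H ^ 2 * N * (N * S) = 12 / 65536 * (S / (H * A * η)) := by
    have : 65536 * (η ^ 2 * N ^ 2 * H ^ 3 * A) = 1 := by rw [← hη2]; ring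
    rw [← mul_div_assoc, eq_div_iff (by positivity)]
    linear_combination 12 / 65536 * S * this
  have h3 : S / (H * A * η) / 1024 ≤
      1 / (512 * A * η) * ∑ t ∈ Finset.Ico 1 τ, w t * P (t + 1) := by
    rw [div_div, div_le_iff₀ (by positivity)]
    have e : 1 / (512 * A * η) * (∑ t ∈ Finset.Ico 1 τ, w t * P (t + 1)) * (H * A * η * 1024) =
      2 * H * ∑ t ∈ Finset.Ico 1 τ, w t * P (t + 1) := by
      field_simp
      ring
    rw [e]
    linarith
  -- In units of S/(65536 H A η), the positive movement term is 12 and the negative one at least 64,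
  -- which leaves 52. Then 1 + 12/52 ≤ 5/4.
  have h4 : 12 * η * H ^ 2 * N * S ≤ 12 / 52 * C := by
    have h5 : N * (12 * η * H ^ 2 * N * S) = 12 / 65536 * (S / (H * A * η)) := by
      rw [← hη2']; ring
    refine le_of_mul_le_mul_left ?_ (show (0 : ℝ) < N by linarith)
    rw [h5] at hsum ⊢
    linarith
  have h5 := hreg i φ
  have h6 : 0 ≤ 1 / (512 * A * η) * ∑ t ∈ Finset.Ico 1 τ, w t * D i (t + 1) ^ 2 := by
    refine mul_nonneg (by positivity) (Finset.sum_nonneg fun t ht => ?_)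
    exact mul_nonneg (hwp t (Finset.mem_Ico.1 ht).1).le (sq_nonneg _)
  have hC0 : 0 ≤ C := by
    have h7 := hwp τ hτ
    have h8 : 0 ≤ ∑ j ∈ Finset.Icc 1 τ, w j :=
      Finset.sum_nonneg fun j hj => (hwp j (Finset.mem_Icc.1 hj).1).le
    have h9 : 0 ≤ ∑ t ∈ Finset.Ico 1 τ, w t * stepSize H t ^ 2 :=
      Finset.sum_nonneg fun j hj =>
        mul_nonneg (hwp j (Finset.mem_Ico.1 hj).1).le (sq_nonneg _)
    positivity
  linarith

/-- Normalized form of `swapRegret_joint_le`. -/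
theorem stepWeight_swapRegret_le (hH : 1 ≤ H) (hT : 2 ≤ T) (hη : 0 < η) {A : ℝ}
    (hη2 : η ^ 2 * (65536 * N ^ 2 * H ^ 3 * A) = 1)
    (hA : ∀ i, (Fintype.card (X i) : ℝ) ≤ A) (hA1 : 1 ≤ A)
    {p u : (i : Fin N) → ℕ → X i → ℝ} {q : (i : Fin N) → ℕ → X i → X i → ℝ}
    (h : ∀ i, IsSwapLearner H η T (p i) (u i) (q i))
    (hu : ∀ i t, 1 ≤ t → t ≤ T → ∀ b, |u i t b - u i (t - 1) b| ≤
      stepSize H t * H + H * ∑ k, ∑ b, |p k t b - p k (t - 1) b|)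
    (i : Fin N) (φ : X i → X i) {τ : ℕ} (hτ : 1 ≤ τ) (hτT : τ ≤ T) :
    ∑ j ∈ Finset.Icc 1 τ, stepWeight H τ j * ∑ c, p i j c * (u i j (φ c) - u i j c) ≤
      3 * (H * A ^ 2 * Real.log T / η) / τ := by
  have hN : (1 : ℝ) ≤ N := by exact_mod_cast i.pos
  have hH' : (1 : ℝ) ≤ H := by exact_mod_cast hH
  have hτ' : (1 : ℝ) ≤ τ := by exact_mod_cast hτ
  have hτT' : (τ : ℝ) ≤ T := by exact_mod_cast hτT
  have hηH : η * H ≤ 1 / 256 := by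
    have h1 : (η * H) ^ 2 ≤ (1 / 256) ^ 2 := by
      have h2 : (1 : ℝ) ≤ N ^ 2 * H * A :=
        one_le_mul_of_one_le_of_one_le (one_le_mul_of_one_le_of_one_le (one_le_pow₀ hN) hH') hA1
      have h3 := mul_le_mul_of_nonneg_left h2 (show 0 ≤ η ^ 2 * H ^ 2 by positivity)
      have h4 : η ^ 2 * H ^ 2 * (N ^ 2 * H * A) = 1 / 65536 := by linarith
      rw [mul_pow]
      linarith
    exact le_of_sq_le_sq h1 (by norm_num)
  have hs := stepWeight_one_pos (H := H) hτ
  have hmain := mul_le_mul_of_nonneg_left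
    (swapRegret_joint_le hH hη hη2 hηH hA hA1 h hu i φ hτ hτT) hs.le
  have e1 : ∀ f : ℕ → ℝ, stepWeight H τ 1 * ∑ j ∈ Finset.Icc 1 τ, oftrlWeight H j j * f j =
      ∑ j ∈ Finset.Icc 1 τ, stepWeight H τ j * f j := fun f => by
    rw [Finset.mul_sum]
    refine Finset.sum_congr rfl fun j hj => ?_
    rw [stepWeight_eq (Finset.mem_Icc.1 hj).1 (Finset.mem_Icc.1 hj).2, mul_assoc]
  rw [e1] at hmain
  refine hmain.trans ?_
  have e2 : stepWeight H τ 1 * oftrlWeight H τ τ = stepSize H τ := by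
    rw [← stepWeight_eq hτ le_rfl, stepWeight_self hτ]
  have e3 : stepWeight H τ 1 * ∑ j ∈ Finset.Icc 1 τ, oftrlWeight H j j = 1 := by
    rw [← sum_stepWeight H τ hτ]
    simpa using e1 fun _ => 1
  have hα : stepSize H τ ≤ 2 * H / τ := by
    rw [stepSize]
    gcongr <;> linarith
  have e4 : stepWeight H τ 1 * ∑ t ∈ Finset.Ico 1 τ, oftrlWeight H t t * stepSize H t ^ 2 ≤
      4 * H / τ := by
    calc stepWeight H τ 1 * ∑ t ∈ Finset.Ico 1 τ, oftrlWeight H t t * stepSize H t ^ 2 ≤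
          stepWeight H τ 1 * ∑ t ∈ Finset.Icc 1 τ, oftrlWeight H t t * stepSize H t ^ 2 := by
          refine mul_le_mul_of_nonneg_left ?_ hs.le
          exact Finset.sum_le_sum_of_subset_of_nonneg Finset.Ico_subset_Icc_self
            fun j hj _ => mul_nonneg (oftrlWeight_pos (Finset.mem_Icc.1 hj).1).le (sq_nonneg _)
      _ = ∑ t ∈ Finset.Icc 1 τ, stepWeight H τ t * stepSize H t ^ 2 := e1 _
      _ ≤ ∑ t ∈ Finset.Icc 1 τ, (H + 1) * (stepWeight H τ t / t) := by
        refine Finset.sum_le_sum fun t ht => ?_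
        have ht1 := (Finset.mem_Icc.1 ht).1
        have ht0 : (0 : ℝ) < t := by exact_mod_cast ht1
        have h1 := stepSize_le_one H t ht1
        have h2 : stepSize H t ≤ (H + 1) / t := by
          rw [stepSize]
          gcongr
          linarith
        have h0 : 0 ≤ stepSize H t := by rw [stepSize]; positivity
        have h3 : stepSize H t ^ 2 ≤ (H + 1) / t := by nlinarith
        calc stepWeight H τ t * stepSize H t ^ 2 ≤ stepWeight H τ t * ((H + 1) / t) :=
              mul_le_mul_of_nonneg_left h3 (stepWeight_nonneg H τ t)
          _ = _ := by ring
      _ ≤ (H + 1) * ((1 + 1 / H) / τ) := by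
        rw [← Finset.mul_sum]
        exact mul_le_mul_of_nonneg_left (sum_stepWeight_div_le hH hτ) (by positivity)
      _ ≤ 2 * H * (2 / τ) := by
        have : (1 : ℝ) / H ≤ 1 := (div_le_one (by positivity)).2 hH'
        gcongr <;> linarith
      _ = 4 * H / τ := by ring
  set B := H * A ^ 2 * Real.log T / η / τ with hB
  have hlog : 1 / 2 ≤ Real.log T := by
    have h1 : Real.log 2 ≤ Real.log T :=
      Real.log_le_log (by norm_num) (by exact_mod_cast hT)
    linarith [Real.log_two_gt_d9]
  -- Since 1/η ≥ 256 H, A ≥ 1 and log T ≥ 1/2, the lower-order terms are small fractions of `B`; the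
  -- total is 5/4 (2 + 6/128) B ≤ 3 B.
  have hHB : (H : ℝ) ^ 2 / τ ≤ B / 128 := by
    rw [hB]
    have h1 : 256 * (H : ℝ) ≤ 1 / η := by
      rw [le_div_iff₀ hη]; linarith
    have h2 : (H : ℝ) ^ 2 ≤ H * A ^ 2 * Real.log T / η / 128 := by
      calc (H : ℝ) ^ 2 = H * 1 * (1 / 2) * (256 * H) / 128 := by ring
        _ ≤ H * A ^ 2 * Real.log T * (1 / η) / 128 := by
          have : (1 : ℝ) ≤ A ^ 2 := one_le_pow₀ hA1
          gcongr
        _ = _ := by ring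
    calc (H : ℝ) ^ 2 / τ ≤ H * A ^ 2 * Real.log T / η / 128 / τ := by gcongr
      _ = _ := by ring
  have t1 : stepSize H τ / η * (A ^ 2 * Real.log T) ≤ 2 * B := by
    calc stepSize H τ / η * (A ^ 2 * Real.log T) ≤ 2 * H / τ / η * (A ^ 2 * Real.log T) := by
          gcongr
      _ = 2 * B := by rw [hB]; ring
  have t2 : 2 * H * stepSize H τ ≤ 4 * (B / 128) := by
    calc 2 * H * stepSize H τ ≤ 2 * H * (2 * H / τ) := by gcongr
      _ = 4 * (H ^ 2 / τ) := by ring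
      _ ≤ _ := by gcongr
  have t3 : (H : ℝ) / T ≤ B / 128 := by
    calc (H : ℝ) / T ≤ H ^ 2 / τ := by
          gcongr
          exact le_self_pow₀ hH' two_ne_zero
      _ ≤ _ := hHB
  have t4 : 8 * η * (H : ℝ) ^ 2 * (4 * H / τ) ≤ B / 128 := by
    calc 8 * η * (H : ℝ) ^ 2 * (4 * H / τ) = 32 * (η * H) * ((H : ℝ) ^ 2 / τ) := by ring
      _ ≤ 32 * (1 / 256) * ((H : ℝ) ^ 2 / τ) := by gcongr
      _ ≤ (H : ℝ) ^ 2 / τ := by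
        have : (0 : ℝ) ≤ (H : ℝ) ^ 2 / τ := by positivity
        linarith
      _ ≤ _ := hHB
  have t5 := mul_le_mul_of_nonneg_left e4 (show 0 ≤ 8 * η * (H : ℝ) ^ 2 by positivity)
  have hB0 : 0 ≤ B := by rw [hB]; positivity
  have e5 : 3 * (H * A ^ 2 * Real.log T / η) / τ = 3 * B := by rw [hB]; ring
  rw [e5]
  have e6 : ∀ c1 c2 c3 c4 W F : ℝ, stepWeight H τ 1 * (5 / 4 * (oftrlWeight H τ τ / η * c1
      + c2 * oftrlWeight H τ τ + c3 * W + c4 * F)) = 5 / 4 * (stepSize H τ / η * c1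
      + c2 * stepSize H τ + c3 * (stepWeight H τ 1 * W) + c4 * (stepWeight H τ 1 * F)) := by
    intros
    rw [← e2]
    ring
  rw [e6, e3, mul_one]
  linarith

end JointLearning

/-! ### ℓ¹ distance of product distributions. -/

section ProductDistributions

variable {ι : Type*} [Fintype ι] [DecidableEq ι] {X : ι → Type*} [∀ i, Fintype (X i)]

/-- Factors are exchanged one at a time; in each exchange the other factors sum to one, which leaves
the ℓ¹ distance of the exchanged factor. -/
theorem sum_abs_prod_sub_prod_le {x x' : (i : ι) → X i → ℝ}
    (hx : ∀ i, x i ∈ stdSimplex ℝ (X i)) (hx' : ∀ i, x' i ∈ stdSimplex ℝ (X i)) :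
    ∑ a : ∀ i, X i, |∏ i, x' i (a i) - ∏ i, x i (a i)| ≤ ∑ i, ∑ b, |x' i b - x i b| := by
  have key : ∀ s : Finset ι, ∑ a : ∀ i, X i,
      |∏ i, (if i ∈ s then x' i (a i) else x i (a i)) - ∏ i, x i (a i)| ≤
        ∑ i ∈ s, ∑ b, |x' i b - x i b| := by
    intro s
    induction s using Finset.induction_on with
    | empty => simp
    | insert j s hj ih =>
      let y : (i : ι) → X i → ℝ := fun i b => if i ∈ s then x' i b else x i b
      have hy : ∀ i, y i ∈ stdSimplex ℝ (X i) := fun i => by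
        by_cases h : i ∈ s
        · simpa [y, h] using hx' i
        · simpa [y, h] using hx i
      let z : (i : ι) → X i → ℝ := Function.update y j fun b => |x' j b - x j b|
      have hz : ∀ a : ∀ i, X i,
          |∏ i, (if i ∈ insert j s then x' i (a i) else x i (a i)) - ∏ i, y i (a i)| =
            ∏ i, z i (a i) := by
        intro a
        rw [← Finset.mul_prod_erase _ _ (Finset.mem_univ j),
          ← Finset.mul_prod_erase _ (fun i => y i (a i)) (Finset.mem_univ j),
          ← Finset.mul_prod_erase _ (fun i => z i (a i)) (Finset.mem_univ j)]
        have e1 : ∏ i ∈ Finset.univ.erase j,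
            (if i ∈ insert j s then x' i (a i) else x i (a i)) =
            ∏ i ∈ Finset.univ.erase j, y i (a i) :=
          Finset.prod_congr rfl fun i hi => by
            simp [y, (Finset.mem_erase.1 hi).1]
        have e2 : ∏ i ∈ Finset.univ.erase j, z i (a i) =
            ∏ i ∈ Finset.univ.erase j, y i (a i) :=
          Finset.prod_congr rfl fun i hi => by
            simp [z, (Finset.mem_erase.1 hi).1]
        have e3 : 0 ≤ ∏ i ∈ Finset.univ.erase j, y i (a i) :=
          Finset.prod_nonneg fun i _ => (hy i).1 _
        rw [e1, e2, ← sub_mul, abs_mul, abs_of_nonneg e3]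
        simp [y, z, hj]
      have hzs : ∑ a : ∀ i, X i, ∏ i, z i (a i) = ∑ b, |x' j b - x j b| := by
        rw [← Fintype.prod_sum, Finset.prod_eq_single j]
        · simp [z]
        · intro i _ hij
          simpa [z, hij] using (hy i).2
        · simp
      rw [Finset.sum_insert hj]
      calc _ ≤ ∑ a : ∀ i, X i,
            (|∏ i, (if i ∈ insert j s then x' i (a i) else x i (a i)) - ∏ i, y i (a i)|
              + |∏ i, y i (a i) - ∏ i, x i (a i)|) :=
            Finset.sum_le_sum fun a _ => abs_sub_le _ _ _
        _ ≤ _ := by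
          rw [Finset.sum_add_distrib, Finset.sum_congr rfl fun a _ => hz a, hzs]
          exact add_le_add le_rfl ih
  simpa using key Finset.univ

theorem prod_mem_stdSimplex {x : (i : ι) → X i → ℝ} (hx : ∀ i, x i ∈ stdSimplex ℝ (X i)) :
    (fun a : ∀ i, X i => ∏ i, x i (a i)) ∈ stdSimplex ℝ (∀ i, X i) :=
  ⟨fun a => Finset.prod_nonneg fun i _ => (hx i).1 _, by
    rw [← Fintype.prod_sum]
    exact Finset.prod_eq_one fun i _ => (hx i).2⟩

end ProductDistributions

theorem sum_mul_mem_Icc {X : Type*} [Fintype X] {x : X → ℝ} (hx : x ∈ stdSimplex ℝ X) {f : X → ℝ}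
    {l r : ℝ} (hf : ∀ a, f a ∈ Set.Icc l r) : ∑ a, f a * x a ∈ Set.Icc l r := by
  constructor
  · calc l = ∑ a, l * x a := by rw [← Finset.mul_sum, hx.2, mul_one]
      _ ≤ _ := Finset.sum_le_sum fun a _ => mul_le_mul_of_nonneg_right (hf a).1 (hx.1 a)
  · calc _ ≤ ∑ a, r * x a :=
          Finset.sum_le_sum fun a _ => mul_le_mul_of_nonneg_right (hf a).2 (hx.1 a)
      _ = r := by rw [← Finset.mul_sum, hx.2, mul_one]

/-! ### Expectations of `Q` under product policies. -/

section Evaluation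

universe u v

variable {N H : ℕ} {S : Type u} {A : Fin N → Type v} [∀ i, Fintype (A i)]

open scoped Classical in
/-- The product distribution with agent `i` playing `b`. -/
noncomputable def othersMixed (π : ProductPolicy N H S A) (h : Fin H) (i : Fin N) (s : S)
    (b : A i) : (k : Fin N) → A k → ℝ :=
  Function.update (fun k => (π k h s).1) i (Pi.single b 1)

theorem othersMixed_mem (π : ProductPolicy N H S A) (h : Fin H) (i : Fin N) (s : S) (b : A i)
    (k : Fin N) : othersMixed π h i s b k ∈ stdSimplex ℝ (A k) := by
  classical
  by_cases hk : k = i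
  · subst hk
    rw [othersMixed, Function.update_self]
    convert single_mem_stdSimplex ℝ b
  · rw [othersMixed, Function.update_of_ne hk]
    exact (π k h s).2

theorem evalOthers_eq (Q : S → JointAction A → ℝ) (π : ProductPolicy N H S A) (h : Fin H)
    (i : Fin N) (s : S) (b : A i) :
    evalOthers Q π h i s b = ∑ a, Q s a * ∏ k, othersMixed π h i s b k (a k) := by
  classical
  rw [evalOthers, Finset.sum_filter]
  refine Finset.sum_congr rfl fun a _ => ?_
  rw [← Finset.mul_prod_erase _ (fun k => othersMixed π h i s b k (a k)) (Finset.mem_univ i)]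
  have e1 : ∏ k ∈ Finset.univ.erase i, othersMixed π h i s b k (a k) =
      ∏ k ∈ Finset.univ.erase i, (π k h s).1 (a k) :=
    Finset.prod_congr rfl fun k hk => by
      rw [othersMixed, Function.update_of_ne (Finset.mem_erase.1 hk).1]
  have e2 : othersMixed π h i s b i (a i) = if a i = b then 1 else 0 := by
    rw [othersMixed, Function.update_self, Pi.single_apply]
  rw [e1, e2]
  split_ifs <;> simp

theorem evalOthers_mem_Icc {Q : S → JointAction A → ℝ} {l r : ℝ} {s : S}
    (hQ : ∀ a, Q s a ∈ Set.Icc l r) (π : ProductPolicy N H S A) (h : Fin H) (i : Fin N) (b : A i) :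
    evalOthers Q π h i s b ∈ Set.Icc l r := by
  rw [evalOthers_eq]
  exact sum_mul_mem_Icc (prod_mem_stdSimplex (othersMixed_mem π h i s b)) hQ

theorem evalJoint_mem_Icc {Q : S → JointAction A → ℝ} {l r : ℝ} {s : S}
    (hQ : ∀ a, Q s a ∈ Set.Icc l r) (π : ProductPolicy N H S A) (h : Fin H) :
    evalJoint Q π h s ∈ Set.Icc l r := sum_mul_mem_Icc (jointMixed π h s).2 hQ

/-- Agent `i`'s own factor is the same point mass on both sides and contributes nothing; its
movement is included in the bound so that the bound is common to all agents. -/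
theorem abs_evalOthers_sub_le {Q Q' : S → JointAction A → ℝ} {s : S} {ε B : ℝ}
    (hQ : ∀ a, Q s a ∈ Set.Icc 0 B) (hQQ : ∀ a, |Q' s a - Q s a| ≤ ε)
    (π π' : ProductPolicy N H S A) (h : Fin H) (i : Fin N) (b : A i) :
    |evalOthers Q' π' h i s b - evalOthers Q π h i s b| ≤
      ε + B * ∑ k, ∑ c, |(π' k h s).1 c - (π k h s).1 c| := by
  classical
  obtain ⟨⟨a₀, -⟩⟩ | hne := em (∃ a : JointAction A, True)
  swap
  · have : IsEmpty (JointAction A) := ⟨fun a => hne ⟨a, trivial⟩⟩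
    have h2 := (prod_mem_stdSimplex (othersMixed_mem π h i s b)).2
    simp at h2
  have hB : 0 ≤ B := (hQ a₀).1.trans (hQ a₀).2
  rw [evalOthers_eq, evalOthers_eq]
  set W := fun a : JointAction A => ∏ k, othersMixed π h i s b k (a k)
  set W' := fun a : JointAction A => ∏ k, othersMixed π' h i s b k (a k)
  have hW' : W' ∈ stdSimplex ℝ (JointAction A) := prod_mem_stdSimplex (othersMixed_mem π' h i s b)
  have h1 : ∑ a, |W' a - W a| ≤ ∑ k, ∑ c, |(π' k h s).1 c - (π k h s).1 c| := by
    refine (sum_abs_prod_sub_prod_le (othersMixed_mem π h i s b)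
      (othersMixed_mem π' h i s b)).trans (Finset.sum_le_sum fun k _ => ?_)
    by_cases hk : k = i
    · subst hk
      simp only [othersMixed, Function.update_self, sub_self, abs_zero, Finset.sum_const_zero]
      exact Finset.sum_nonneg fun _ _ => abs_nonneg _
    · simp only [othersMixed, Function.update_of_ne hk]
      exact le_rfl
  have e : ∑ a, Q' s a * W' a - ∑ a, Q s a * W a =
      ∑ a, (Q' s a - Q s a) * W' a + ∑ a, Q s a * (W' a - W a) := by
    rw [← Finset.sum_sub_distrib, ← Finset.sum_add_distrib]
    exact Finset.sum_congr rfl fun a _ => by ring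
  change |∑ a, Q' s a * W' a - ∑ a, Q s a * W a| ≤ _
  rw [e]
  refine (abs_add_le _ _).trans (add_le_add ?_ ?_)
  · have := sum_mul_mem_Icc hW' (f := fun a => Q' s a - Q s a) (l := -ε) (r := ε)
      fun a => abs_le.1 (hQQ a)
    exact abs_le.2 this
  · calc |∑ a, Q s a * (W' a - W a)| ≤ ∑ a, |Q s a * (W' a - W a)| :=
          Finset.abs_sum_le_sum_abs _ _
      _ ≤ ∑ a, B * |W' a - W a| := Finset.sum_le_sum fun a _ => by
          rw [abs_mul, abs_of_nonneg (hQ a).1]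
          exact mul_le_mul_of_nonneg_right (hQ a).2 (abs_nonneg _)
      _ ≤ _ := by
        rw [← Finset.mul_sum]
        exact mul_le_mul_of_nonneg_left h1 hB

open scoped Classical in
/-- Expectation of `Q` when agent `i` maps its recommendation through `f`. -/
theorem sum_update_mul_jointMixed (Q : S → JointAction A → ℝ) (π : ProductPolicy N H S A)
    (h : Fin H) (i : Fin N) (s : S) (f : A i → A i) :
    ∑ a, Q s (Function.update a i (f (a i))) * (jointMixed π h s).1 a =
      ∑ c, (π i h s).1 c * evalOthers Q π h i s (f c) := by
  rw [← Finset.sum_fiberwise Finset.univ (fun a : JointAction A => a i)]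
  refine Finset.sum_congr rfl fun c _ => ?_
  rw [evalOthers, Finset.mul_sum]
  -- Between the fibres a i = c and a i = f c, overwriting coordinate `i` is a bijection whether or
  -- not `f` is injective.
  refine Finset.sum_nbij' (fun a => Function.update a i (f c)) (fun a => Function.update a i c)
    ?_ ?_ ?_ ?_ ?_
  · intro a _
    simp
  · intro a _
    simp
  · intro a ha
    have : a i = c := by simpa using ha
    simp [← this]
  · intro a ha
    have : a i = f c := by simpa using ha
    simp [← this]
  · intro a ha
    have hac : a i = c := by simpa using ha
    have e1 : ∏ k ∈ Finset.univ.erase i, (π k h s).1 (Function.update a i (f c) k) =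
        ∏ k ∈ Finset.univ.erase i, (π k h s).1 (a k) :=
      Finset.prod_congr rfl fun k hk => by
        rw [Function.update_of_ne (Finset.mem_erase.1 hk).1]
    rw [e1]
    simp only [jointMixed]
    rw [← Finset.mul_prod_erase _ (fun k => (π k h s).1 (a k)) (Finset.mem_univ i), hac]
    ring

end Evaluation

/-! ### Expected total reward of a finite Markov chain. -/

section MarkovChain

variable {X : Type*} [Fintype X]

theorem sum_chain_weight {n : ℕ} (p₀ : X → ℝ) (K : Fin n → X → X → ℝ)
    (hK : ∀ k x, ∑ y, K k x y = 1) :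
    ∑ ω : Fin (n + 1) → X, p₀ (ω 0) * ∏ k : Fin n, K k (ω k.castSucc) (ω k.succ) = ∑ x, p₀ x := by
  induction n generalizing p₀ with
  | zero =>
    rw [← (Fin.consEquiv fun _ : Fin 1 => X).sum_comp, Fintype.sum_prod_type]
    simp
  | succ n ih =>
    rw [← (Fin.consEquiv fun _ : Fin (n + 2) => X).sum_comp, Fintype.sum_prod_type]
    refine Finset.sum_congr rfl fun x _ => ?_
    have h := ih (K 0 x) (fun k => K k.succ) fun k x => hK k.succ x
    rw [hK] at h
    rw [← mul_one (p₀ x), ← h, Finset.mul_sum]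
    refine Finset.sum_congr rfl fun ω _ => ?_
    simp [Fin.prod_univ_succ, Fin.consEquiv_apply]

/-- Supersolutions of the backward recursion bound the expected total reward of a Markov chain. -/
theorem sum_chain_le {n : ℕ} (p₀ : X → ℝ) (hp₀ : ∀ x, 0 ≤ p₀ x) (K : Fin n → X → X → ℝ)
    (hK0 : ∀ k x y, 0 ≤ K k x y) (hK : ∀ k x, ∑ y, K k x y = 1) (r V : Fin (n + 1) → X → ℝ)
    (hV : ∀ (k : Fin n) x, r k.castSucc x + ∑ y, K k x y * V k.succ y ≤ V k.castSucc x)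
    (hlast : ∀ x, r (Fin.last n) x ≤ V (Fin.last n) x) :
    ∑ ω : Fin (n + 1) → X, (p₀ (ω 0) * ∏ k : Fin n, K k (ω k.castSucc) (ω k.succ)) *
      ∑ k, r k (ω k) ≤ ∑ x, p₀ x * V 0 x := by
  induction n generalizing p₀ with
  | zero =>
    rw [← (Fin.consEquiv fun _ : Fin 1 => X).sum_comp, Fintype.sum_prod_type]
    refine Finset.sum_le_sum fun x _ => ?_
    simpa using mul_le_mul_of_nonneg_left (hlast x) (hp₀ x)
  | succ n ih =>
    rw [← (Fin.consEquiv fun _ : Fin (n + 2) => X).sum_comp, Fintype.sum_prod_type]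
    refine Finset.sum_le_sum fun x _ => ?_
    have h := ih (K 0 x) (hK0 0 x) (fun k => K k.succ) (fun k => hK0 k.succ)
      (fun k => hK k.succ) (fun k => r k.succ) (fun k => V k.succ)
      (fun k x => hV k.succ x)
      hlast
    have h1 := sum_chain_weight (K 0 x) (fun k => K k.succ) fun k x => hK k.succ x
    rw [hK] at h1
    have e : ∀ ω : Fin (n + 1) → X,
        (p₀ x * ∏ k : Fin (n + 1), K k ((Fin.cons x ω : Fin (n + 2) → X) k.castSucc)
          ((Fin.cons x ω : Fin (n + 2) → X) k.succ)) *
          ∑ k, r k ((Fin.cons x ω : Fin (n + 2) → X) k) =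
        p₀ x * (r 0 x * (K 0 x (ω 0) * ∏ k : Fin n, K k.succ (ω k.castSucc) (ω k.succ)) +
          (K 0 x (ω 0) * ∏ k : Fin n, K k.succ (ω k.castSucc) (ω k.succ)) *
            ∑ k, r k.succ (ω k)) := fun ω => by
      rw [Fin.prod_univ_succ, Fin.sum_univ_succ]
      simp only [Fin.castSucc_zero, Fin.cons_zero, Fin.cons_succ, ← Fin.succ_castSucc]
      ring
    have e2 : ∀ ω : Fin (n + 1) → X,
        (Fin.consEquiv fun _ : Fin (n + 2) => X) (x, ω) = (Fin.cons x ω : Fin (n + 2) → X) :=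
      fun _ => rfl
    simp only [e2, Fin.cons_zero, e]
    rw [← Finset.mul_sum, Finset.sum_add_distrib, ← Finset.mul_sum, h1, mul_one]
    refine mul_le_mul_of_nonneg_left ?_ (hp₀ x)
    have := hV 0 x
    simp only [Fin.castSucc_zero] at this
    linarith

end MarkovChain

/-! ### The sampled policy as a Markov chain on (iteration, state, joint action). -/

section Values

universe u v

variable {N : ℕ} {S : Type u} [Fintype S] {A : Fin N → Type v} [∀ i, Fintype (A i)]

theorem integral_chainMeasure (H T n : ℕ) (f : (Fin n → Finset.Icc 1 T) → ℝ) :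
    ∫ τ, f τ ∂chainMeasure H T n = ∑ τ, chainProb H T T τ * f τ := by
  rw [chainMeasure, MeasureTheory.integral_finsetSum_measure fun _ _ => by
    exact (MeasureTheory.Integrable.of_finite).smul_measure ENNReal.ofReal_ne_top]
  refine Finset.sum_congr rfl fun τ _ => ?_
  rw [MeasureTheory.integral_smul_measure, MeasureTheory.integral_dirac,
    ENNReal.toReal_ofReal (chainProb_nonneg H T T τ), smul_eq_mul]

open scoped Classical in
/-- Initial law of the chain (sampled iteration, state, joint action). -/
noncomputable def chainInit {n : ℕ} (G : MarkovGame N (n + 1) S A) (T : ℕ)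
    (σ : Fin (n + 1) → ℕ → S → stdSimplex ℝ (JointAction A))
    (x : Finset.Icc 1 T × S × JointAction A) : ℝ :=
  stepWeight (n + 1) T x.1 * ((if x.2.1 = G.init then 1 else 0) * (σ 0 x.1 x.2.1).1 x.2.2)

/-- Kernel of the chain (sampled iteration, state, joint action). -/
noncomputable def chainKernel {n : ℕ} (G : MarkovGame N (n + 1) S A) (T : ℕ)
    (σ : Fin (n + 1) → ℕ → S → stdSimplex ℝ (JointAction A)) (k : Fin n)
    (x y : Finset.Icc 1 T × S × JointAction A) : ℝ :=
  stepWeight (n + 1) x.1 y.1 *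
    ((G.trans k.castSucc x.2.1 x.2.2).1 y.2.1 * (σ k.succ y.1 y.2.1).1 y.2.2)

variable {n T : ℕ} (G : MarkovGame N (n + 1) S A)
  (σ : Fin (n + 1) → ℕ → S → stdSimplex ℝ (JointAction A))

theorem sum_chainInit_mul (V : Finset.Icc 1 T × S × JointAction A → ℝ) :
    ∑ x, chainInit G T σ x * V x =
      ∑ j : Finset.Icc 1 T, stepWeight (n + 1) T j *
        ∑ a, (σ 0 j G.init).1 a * V (j, G.init, a) := by
  classical
  rw [Fintype.sum_prod_type]
  refine Finset.sum_congr rfl fun j _ => ?_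
  rw [Fintype.sum_prod_type, Finset.sum_eq_single G.init]
  · rw [Finset.mul_sum]
    exact Finset.sum_congr rfl fun a _ => by simp [chainInit, mul_assoc]
  · intro s _ hs
    exact Finset.sum_eq_zero fun a _ => by simp [chainInit, hs]
  · simp

theorem sum_chainKernel_mul (k : Fin n) (x : Finset.Icc 1 T × S × JointAction A)
    (V : Finset.Icc 1 T × S × JointAction A → ℝ) :
    ∑ y, chainKernel G T σ k x y * V y =
      ∑ s, (G.trans k.castSucc x.2.1 x.2.2).1 s *
        ∑ j : Finset.Icc 1 T, stepWeight (n + 1) x.1 j * ∑ a, (σ k.succ j s).1 a * V (j, s, a) := by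
  rw [Fintype.sum_prod_type]
  simp only [Fintype.sum_prod_type, chainKernel, Finset.mul_sum]
  rw [Finset.sum_comm]
  exact Finset.sum_congr rfl fun s _ => Finset.sum_congr rfl fun j _ =>
    Finset.sum_congr rfl fun a _ => by ring

theorem sum_chainKernel (k : Fin n) (x : Finset.Icc 1 T × S × JointAction A) :
    ∑ y, chainKernel G T σ k x y = 1 := by
  have h := sum_chainKernel_mul G σ k x fun _ => 1
  simp only [mul_one] at h
  obtain ⟨h1, h2⟩ := Finset.mem_Icc.1 x.1.2
  rw [h, Finset.sum_congr rfl fun s _ => by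
    rw [Finset.sum_congr rfl fun j _ => by rw [(σ k.succ j s).2.2, mul_one],
      sum_stepWeight_subtype (n + 1) T x.1 h1 h2, mul_one]]
  exact (G.trans k.castSucc x.2.1 x.2.2).2.2

theorem chainInit_nonneg (x : Finset.Icc 1 T × S × JointAction A) : 0 ≤ chainInit G T σ x := by
  refine mul_nonneg (stepWeight_nonneg _ _ _) (mul_nonneg ?_ ((σ 0 x.1 x.2.1).2.1 _))
  split_ifs <;> norm_num

theorem chainKernel_nonneg (k : Fin n) (x y : Finset.Icc 1 T × S × JointAction A) :
    0 ≤ chainKernel G T σ k x y :=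
  mul_nonneg (stepWeight_nonneg _ _ _)
    (mul_nonneg ((G.trans _ _ _).2.1 _) ((σ k.succ y.1 y.2.1).2.1 _))

/-- The value of a policy that plays by the sampled iterations, as an expectation over a chain. -/
theorem value_eq_sum_chain (P : CorrelatedPolicy (n + 1) S A (Fin (n + 1) → Finset.Icc 1 T))
    (hseed : P.seed = chainMeasure (n + 1) T (n + 1))
    (hact : ∀ h τ hist s, P.act h τ hist s = σ h (τ h) s) (i : Fin N) :
    value G P i = ∑ ω : Fin (n + 1) → Finset.Icc 1 T × S × JointAction A,
      (chainInit G T σ (ω 0) * ∏ k : Fin n, chainKernel G T σ k (ω k.castSucc) (ω k.succ)) *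
        ∑ k, G.reward k i (ω k).2.1 (ω k).2.2 := by
  classical
  rw [value, hseed, integral_chainMeasure]
  simp only [Finset.mul_sum]
  -- Seed sequence and trajectory are paired coordinatewise. The result is a Markov chain, because
  -- each draw depends only on the previous draw and the play only on the current draw and state.
  rw [← Fintype.sum_prod_type', ← (Equiv.arrowProdEquivProdArrow (Fin (n + 1))
    (fun _ => Finset.Icc 1 T) (fun _ => S × JointAction A)).sum_comp]
  refine Finset.sum_congr rfl fun ω _ => ?_
  simp only [Equiv.arrowProdEquivProdArrow_apply, ← Finset.mul_sum]
  rw [← mul_assoc]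
  congr 1
  rw [chainProb, trajProb, ← Finset.prod_mul_distrib, Fin.prod_univ_succ]
  congr 1
  · simp [chainInit, stateProb, hact]
  · refine Finset.prod_congr rfl fun k _ => ?_
    rw [hact, ← Fin.succ_castSucc, Fin.cons_succ]
    simp only [chainKernel, stateProb, Fin.val_succ, Nat.add_one_ne_zero, dite_false]
    rfl

open scoped Classical in
theorem sum_pushSimplex_mul {X Y : Type*} [Fintype X] [Fintype Y] (f : X → Y)
    (x : stdSimplex ℝ X) (g : Y → ℝ) :
    ∑ y, (pushSimplex f x).1 y * g y = ∑ a, x.1 a * g (f a) := by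
  rw [← Finset.sum_fiberwise Finset.univ f]
  refine Finset.sum_congr rfl fun y _ => ?_
  simp only [pushSimplex]
  rw [Finset.sum_mul]
  refine Finset.sum_congr rfl fun a ha => ?_
  rw [(Finset.mem_filter.1 ha).2]

end Values

/-! ### The dynamics: `Q` as action values, ranges, and reduction to swap learners. -/

section Run

universe u v

variable {N H : ℕ} {S : Type u} [Fintype S] {A : Fin N → Type v} [∀ i, Fintype (A i)]
  {G : MarkovGame N H S A} {η : ℝ} {T : ℕ} {π : ℕ → ProductPolicy N H S A}
  {q : ℕ → (i : Fin N) → Fin H → S → A i → A i → ℝ}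
  {Q : ℕ → Fin N → Fin H → S → JointAction A → ℝ}

namespace IsBMOFTRLRun

/-- The `Q`-estimates are averages of Bellman backups. -/
theorem Q_eq_sum_bellman (hrun : IsBMOFTRLRun G η T π q Q) (i : Fin N) (h : Fin H) (s : S)
    (a : JointAction A) {t : ℕ} (ht : 1 ≤ t) (htT : t ≤ T) :
    Q t i h s a = ∑ j ∈ Finset.Icc 1 t, stepWeight H t j * bellman G i (Q j i) (π j) h s a := by
  induction t, ht using Nat.le_induction with
  | base =>
    have h1 : stepSize H 1 = 1 := by
      have : (H : ℝ) + 1 ≠ 0 := by positivity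
      simp [stepSize, this]
    rw [hrun.value_update 1 le_rfl htT]
    simp [stepWeight_self, h1]
  | succ t ht ih =>
    rw [hrun.value_update (t + 1) (by omega) htT, Nat.add_sub_cancel, ih (by omega),
      Finset.sum_Icc_succ_top (by omega), stepWeight_self (by omega), Finset.mul_sum]
    congr 1
    refine Finset.sum_congr rfl fun j hj => ?_
    rw [stepWeight_succ (Finset.mem_Icc.1 hj).2]
    ring

/-- The `Q`-estimates are the exact action values of the sampled policy. -/
theorem Q_eq (hrun : IsBMOFTRLRun G η T π q Q) (i : Fin N) (h : Fin H) (s : S)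
    (a : JointAction A) {t : ℕ} (ht : 1 ≤ t) (htT : t ≤ T) :
    Q t i h s a = G.reward h i s a + if hh : (h : ℕ) + 1 < H then
      ∑ s', (G.trans h s a).1 s' * ∑ j ∈ Finset.Icc 1 t,
        stepWeight H t j * evalJoint (Q j i ⟨h + 1, hh⟩) (π j) ⟨h + 1, hh⟩ s' else 0 := by
  rw [hrun.Q_eq_sum_bellman i h s a ht htT]
  simp only [bellman, mul_add, Finset.sum_add_distrib]
  rw [← Finset.sum_mul, sum_stepWeight H t ht, one_mul]
  congr 1
  split_ifs with hh
  · simp only [Finset.mul_sum]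
    rw [Finset.sum_comm]
    exact Finset.sum_congr rfl fun s' _ => Finset.sum_congr rfl fun j _ => by ring
  · simp

/-- Here `m` counts the steps after `h`, and the induction runs backward from the last step. -/
theorem Q_mem_Icc_sub (hrun : IsBMOFTRLRun G η T π q Q) (i : Fin N) (m : ℕ) (h : Fin H)
    (hm : (h : ℕ) + m + 1 = H) (s : S) (a : JointAction A) {t : ℕ} (ht : 1 ≤ t) (htT : t ≤ T) :
    Q t i h s a ∈ Set.Icc (0 : ℝ) (m + 1) := by
  induction m generalizing h s a t with
  | zero =>
    rw [hrun.Q_eq i h s a ht htT, dif_neg (by omega)]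
    simpa using G.reward_mem h i s a
  | succ m ih =>
    rw [hrun.Q_eq i h s a ht htT, dif_pos (by omega)]
    have hw : ∀ s', ∑ j ∈ Finset.Icc 1 t, stepWeight H t j *
        evalJoint (Q j i ⟨h + 1, by omega⟩) (π j) ⟨h + 1, by omega⟩ s' ∈
        Set.Icc (0 : ℝ) (m + 1) := fun s' => by
      have hj : ∀ j ∈ Finset.Icc 1 t, evalJoint (Q j i ⟨h + 1, by omega⟩) (π j)
          ⟨h + 1, by omega⟩ s' ∈ Set.Icc (0 : ℝ) (m + 1) := fun j hj => by
        obtain ⟨h1, h2⟩ := Finset.mem_Icc.1 hj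
        exact evalJoint_mem_Icc (fun a => ih _ (by simp only; omega) s' a h1 (h2.trans htT)) _ _
      refine ⟨Finset.sum_nonneg fun j hj' => mul_nonneg (stepWeight_nonneg _ _ _) (hj j hj').1, ?_⟩
      calc _ ≤ ∑ j ∈ Finset.Icc 1 t, stepWeight H t j * ((m : ℝ) + 1) :=
            Finset.sum_le_sum fun j hj' =>
              mul_le_mul_of_nonneg_left (hj j hj').2 (stepWeight_nonneg _ _ _)
        _ = m + 1 := by rw [← Finset.sum_mul, sum_stepWeight H t ht, one_mul]
    have h1 := sum_mul_mem_Icc (G.trans h s a).2 hw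
    have h2 := G.reward_mem h i s a
    simp only [mul_comm ((G.trans h s a).1 _)]
    push_cast
    exact ⟨add_nonneg h2.1 h1.1, by linarith [h2.2, h1.2]⟩

theorem Q_mem_Icc (hrun : IsBMOFTRLRun G η T π q Q) (i : Fin N) (h : Fin H) (s : S)
    (a : JointAction A) {t : ℕ} (htT : t ≤ T) : Q t i h s a ∈ Set.Icc (0 : ℝ) H := by
  rcases Nat.eq_zero_or_pos t with rfl | ht
  · rw [hrun.init_Q]
    exact ⟨le_rfl, by positivity⟩
  · have := hrun.Q_mem_Icc_sub i (H - h - 1) h (by omega) s a ht htT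
    refine ⟨this.1, this.2.trans ?_⟩
    exact_mod_cast (show H - h - 1 + 1 ≤ H by omega)

theorem bellman_mem_Icc (hrun : IsBMOFTRLRun G η T π q Q) (i : Fin N) (h : Fin H) (s : S)
    (a : JointAction A) {t : ℕ} (ht : 1 ≤ t) (htT : t ≤ T) :
    bellman G i (Q t i) (π t) h s a ∈ Set.Icc (0 : ℝ) H := by
  have h2 := G.reward_mem h i s a
  rw [bellman]
  split_ifs with hh
  · have h1 := sum_mul_mem_Icc (G.trans h s a).2 (f := fun s' =>
      evalJoint (Q t i ⟨h + 1, hh⟩) (π t) ⟨h + 1, hh⟩ s') (l := 0)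
      (r := ((H - h - 2 : ℕ) : ℝ) + 1) fun s' => evalJoint_mem_Icc (fun a =>
        hrun.Q_mem_Icc_sub i (H - h - 2) _ (by simp only; omega) s' a ht htT) _ _
    simp only [mul_comm ((G.trans h s a).1 _)]
    have h3 : ((H - h - 2 : ℕ) : ℝ) + 1 + 1 ≤ H := by
      exact_mod_cast (show H - h - 2 + 1 + 1 ≤ H by omega)
    exact ⟨add_nonneg h2.1 h1.1, by linarith [h2.2, h1.2]⟩
  · have h3 : (1 : ℝ) ≤ H := by exact_mod_cast (show 1 ≤ H by omega)
    simp only [add_zero]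
    exact ⟨h2.1, h2.2.trans h3⟩

/-- The update is a move by the fraction α_t between two numbers in [0, H]. -/
theorem abs_Q_sub_le (hrun : IsBMOFTRLRun G η T π q Q) (i : Fin N) (h : Fin H) (s : S)
    (a : JointAction A) {t : ℕ} (ht : 1 ≤ t) (htT : t ≤ T) :
    |Q t i h s a - Q (t - 1) i h s a| ≤ stepSize H t * H := by
  have h1 := hrun.bellman_mem_Icc i h s a ht htT
  have h2 := hrun.Q_mem_Icc i h s a (show t - 1 ≤ T by omega)
  have h0 : 0 ≤ stepSize H t := by rw [stepSize]; positivity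
  have e : Q t i h s a - Q (t - 1) i h s a =
      stepSize H t * (bellman G i (Q t i) (π t) h s a - Q (t - 1) i h s a) := by
    rw [hrun.value_update t ht htT]
    ring
  rw [e, abs_mul, abs_of_nonneg h0]
  refine mul_le_mul_of_nonneg_left ?_ h0
  rw [abs_le]
  constructor <;> linarith [h1.1, h1.2, h2.1, h2.2]

theorem isSwapLearner (hrun : IsBMOFTRLRun G η T π q Q) (i : Fin N) (h : Fin H) (s : S) :
    IsSwapLearner H η T (fun t => (π t i h s).1) (fun t => evalOthers (Q t i h) (π t) h i s)
      (fun t => q t i h s) where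
  policy_mem t _ := (π t i h s).2
  utility_mem t ht b := evalOthers_mem_Icc (fun a => hrun.Q_mem_Icc i h s a ht) _ _ _ _
  utility_zero b := by simp [evalOthers, hrun.init_Q]
  policy_zero b := hrun.init_policy i h s b
  base_mem t h1 h2 c := hrun.base_mem t h1 h2 i h s c
  base_max t h1 h2 c := by
    have hm := hrun.base_max t h1 h2 i h s c
    have e : ∀ b, cumUtility π Q t i h s c b =
        ∑ j ∈ Finset.Ico 1 t, oftrlWeight H j j * (π j i h s).1 c *
          evalOthers (Q j i h) (π j) h i s b + oftrlWeight H t t * (π (t - 1) i h s).1 c *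
            evalOthers (Q (t - 1) i h) (π (t - 1)) h i s b := fun b => by
      rw [cumUtility]
      congr 1
      refine Finset.sum_congr rfl fun j hj => ?_
      obtain ⟨h3, h4⟩ := Finset.mem_Ico.1 hj
      rw [oftrlWeight_eq h3 h4.le]
    simpa only [e] using hm
  stationary t h1 h2 b := hrun.stationary t h1 h2 i h s b

/-- Weighted swap regret of the run at each step and state. -/
theorem swapRegret_le (hrun : IsBMOFTRLRun G η T π q Q) (hH : 1 ≤ H) (hT : 2 ≤ T) (hη : 0 < η)
    {B : ℝ} (hη2 : η ^ 2 * (65536 * N ^ 2 * H ^ 3 * B) = 1)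
    (hA : ∀ i, (Fintype.card (A i) : ℝ) ≤ B) (hA1 : 1 ≤ B) (i : Fin N) (h : Fin H) (s : S)
    (φ : A i → A i) {τ : ℕ} (hτ : 1 ≤ τ) (hτT : τ ≤ T) :
    ∑ j ∈ Finset.Icc 1 τ, stepWeight H τ j * ∑ c, (π j i h s).1 c *
      (evalOthers (Q j i h) (π j) h i s (φ c) - evalOthers (Q j i h) (π j) h i s c) ≤
      3 * (H * B ^ 2 * Real.log T / η) / τ := by
  refine stepWeight_swapRegret_le hH hT hη hη2 hA hA1 (fun k => hrun.isSwapLearner k h s)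
    (fun k t ht htT b => ?_) i φ hτ hτT
  exact abs_evalOthers_sub_le (fun a => hrun.Q_mem_Icc k h s a (by omega))
    (fun a => hrun.abs_Q_sub_le k h s a ht htT) _ _ _ _ _

end IsBMOFTRLRun

end Run

/-! ### Backward recursion for the gain of a deviation. -/

section GapRecursion

theorem sum_Icc_coe_stepWeight_mul (H : ℕ) {T t : ℕ} (htT : t ≤ T) (f : ℕ → ℝ) :
    ∑ j : Finset.Icc 1 T, stepWeight H t j * f j =
      ∑ j ∈ Finset.Icc 1 t, stepWeight H t j * f j := by
  rw [Finset.sum_coe_sort (Finset.Icc 1 T) fun j => stepWeight H t j * f j]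
  symm
  refine Finset.sum_subset (Finset.Icc_subset_Icc le_rfl htT) fun j _ hj => ?_
  rw [Finset.mem_Icc] at hj
  simp [stepWeight, hj]

/-- Accumulated gap over `m` remaining steps. -/
noncomputable def gapCoeff (H : ℕ) (K : ℝ) (m : ℕ) : ℝ :=
  K * ∑ l ∈ Finset.range m, (1 + 1 / (H : ℝ)) ^ l

theorem gapCoeff_succ (H : ℕ) (K : ℝ) (m : ℕ) :
    gapCoeff H K (m + 1) = K + (1 + 1 / (H : ℝ)) * gapCoeff H K m := by
  have h : ∑ l ∈ Finset.range m, (1 + 1 / (H : ℝ)) ^ (l + 1) =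
      (1 + 1 / (H : ℝ)) * ∑ l ∈ Finset.range m, (1 + 1 / (H : ℝ)) ^ l := by
    rw [Finset.mul_sum]
    exact Finset.sum_congr rfl fun l _ => pow_succ' _ _
  rw [gapCoeff, gapCoeff, Finset.sum_range_succ', h]
  ring

theorem gapCoeff_nonneg (H : ℕ) {K : ℝ} (hK : 0 ≤ K) (m : ℕ) : 0 ≤ gapCoeff H K m :=
  mul_nonneg hK (Finset.sum_nonneg fun l _ => by positivity)

/-- The geometric sum is H ((1 + 1/H)^H - 1) ≤ H (e - 1) ≤ 2H. -/
theorem gapCoeff_self_le {H : ℕ} (hH : 1 ≤ H) {K : ℝ} (hK : 0 ≤ K) :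
    gapCoeff H K H ≤ 2 * H * K := by
  have hH' : (0 : ℝ) < H := by exact_mod_cast hH
  have h1 : (1 + 1 / (H : ℝ)) ^ H ≤ Real.exp 1 := by
    calc (1 + 1 / (H : ℝ)) ^ H ≤ (Real.exp (1 / H)) ^ H := by
          gcongr
          linarith [Real.add_one_le_exp (1 / (H : ℝ))]
      _ = Real.exp 1 := by
        rw [← Real.exp_nat_mul]
        congr 1
        field_simp
  have h2 : ∑ l ∈ Finset.range H, (1 + 1 / (H : ℝ)) ^ l ≤ 2 * H := by
    rw [geom_sum_eq (by simp [hH'.ne'])]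
    have e : (1 + 1 / (H : ℝ)) - 1 = 1 / H := by ring
    rw [e, div_le_iff₀ (by positivity)]
    have e2 : 2 * (H : ℝ) * (1 / H) = 2 := by field_simp
    rw [e2]
    linarith [Real.exp_one_lt_d9]
  calc gapCoeff H K H ≤ K * (2 * H) := mul_le_mul_of_nonneg_left h2 hK
    _ = _ := by ring

variable {N n : ℕ} {S : Type*} {A : Fin N → Type*} [∀ i, Fintype (A i)] {T : ℕ}
  {π : ℕ → ProductPolicy N (n + 1) S A} {Q : ℕ → Fin N → Fin (n + 1) → S → JointAction A → ℝ}

/-- One backward step of the gap recursion, given a bound `K / τ` on the weighted swap regrets. -/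
theorem sum_modified_le {K : ℝ} {i : Fin N} {φ : StrategyModification (n + 1) S A i}
    (hreg : ∀ (h : Fin (n + 1)) (s : S) (τ : ℕ), 1 ≤ τ → τ ≤ T →
      ∑ j ∈ Finset.Icc 1 τ, stepWeight (n + 1) τ j * ∑ c, (π j i h s).1 c *
        (evalOthers (Q j i h) (π j) h i s (φ h s c) - evalOthers (Q j i h) (π j) h i s c) ≤ K / τ)
    {γ : ℝ} (hγ : 0 ≤ γ) (h : Fin (n + 1)) (s : S) {τ : ℕ} (hτ : 1 ≤ τ) (hτT : τ ≤ T) :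
    ∑ j : Finset.Icc 1 T, stepWeight (n + 1) τ j *
      ∑ a, (pushSimplex (fun a : JointAction A => Function.update a i (φ h s (a i)))
        (jointMixed (π j) h s)).1 a * (Q j i h s a + γ / (j : ℕ)) ≤
      ∑ j ∈ Finset.Icc 1 τ, stepWeight (n + 1) τ j * evalJoint (Q j i h) (π j) h s +
        (K + (1 + 1 / ((n + 1 : ℕ) : ℝ)) * γ) / τ := by
  classical
  -- At iteration `j` the deviating expectation is the obedient one plus the swap gain plus the gap
  -- carried from later steps.
  have e1 : ∀ j : ℕ, ∑ a, (pushSimplex (fun a : JointAction A =>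
        Function.update a i (φ h s (a i))) (jointMixed (π j) h s)).1 a *
          (Q j i h s a + γ / (j : ℕ)) =
      evalJoint (Q j i h) (π j) h s + (∑ c, (π j i h s).1 c *
        (evalOthers (Q j i h) (π j) h i s (φ h s c) - evalOthers (Q j i h) (π j) h i s c)
          + γ * (1 / (j : ℝ))) := by
    intro j
    rw [sum_pushSimplex_mul]
    have a1 := sum_update_mul_jointMixed (Q j i h) (π j) h i s (φ h s)
    have a2 := sum_update_mul_jointMixed (Q j i h) (π j) h i s id
    simp only [id, Function.update_eq_self] at a2
    simp only [mul_add, mul_sub, Finset.sum_add_distrib, Finset.sum_sub_distrib]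
    rw [← Finset.sum_mul, (jointMixed (π j) h s).2.2, evalJoint, ← a1, ← a2, one_mul]
    have a3 : ∀ f : JointAction A → ℝ, ∑ a, (jointMixed (π j) h s).1 a * f a =
        ∑ a, f a * (jointMixed (π j) h s).1 a := fun f =>
      Finset.sum_congr rfl fun a _ => mul_comm _ _
    rw [a3]
    ring
  simp only [e1]
  rw [sum_Icc_coe_stepWeight_mul (n + 1) hτT fun j => evalJoint (Q j i h) (π j) h s +
    (∑ c, (π j i h s).1 c *
        (evalOthers (Q j i h) (π j) h i s (φ h s c) - evalOthers (Q j i h) (π j) h i s c)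
          + γ * (1 / (j : ℝ)))]
  simp only [mul_add, Finset.sum_add_distrib]
  have h1 := hreg h s τ hτ hτT
  have h2 := mul_le_mul_of_nonneg_left (sum_stepWeight_div_le (H := n + 1) (by omega) hτ) hγ
  have e2 : ∑ j ∈ Finset.Icc 1 τ, stepWeight (n + 1) τ j * (γ * (1 / (j : ℝ))) =
      γ * ∑ j ∈ Finset.Icc 1 τ, stepWeight (n + 1) τ j / j := by
    rw [Finset.mul_sum]
    exact Finset.sum_congr rfl fun j _ => by ring
  rw [e2, add_div]
  have e3 : (1 + 1 / ((n + 1 : ℕ) : ℝ)) * γ / τ = γ * ((1 + 1 / ((n + 1 : ℕ) : ℝ)) / τ) := by ring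
  rw [e3]
  linarith

end GapRecursion

/-! ### Value of the output policy and gain of a modification. -/

section Gap

universe u v

variable {N n : ℕ} {S : Type u} [Fintype S] {A : Fin N → Type v} [∀ i, Fintype (A i)]
  {G : MarkovGame N (n + 1) S A} {η : ℝ} {T : ℕ} {π : ℕ → ProductPolicy N (n + 1) S A}
  {q : ℕ → (i : Fin N) → Fin (n + 1) → S → A i → A i → ℝ}
  {Q : ℕ → Fin N → Fin (n + 1) → S → JointAction A → ℝ}

namespace IsBMOFTRLRun

theorem Q_castSucc (hrun : IsBMOFTRLRun G η T π q Q) (i : Fin N) (k : Fin n) (s : S)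
    (a : JointAction A) (t : Finset.Icc 1 T) :
    Q t i k.castSucc s a = G.reward k.castSucc i s a +
      ∑ s', (G.trans k.castSucc s a).1 s' * ∑ j ∈ Finset.Icc 1 (t : ℕ),
        stepWeight (n + 1) t j * evalJoint (Q j i k.succ) (π j) k.succ s' := by
  obtain ⟨h1, h2⟩ := Finset.mem_Icc.1 t.2
  rw [hrun.Q_eq i _ s a h1 h2, dif_pos (by simp)]
  rfl

theorem Q_last (hrun : IsBMOFTRLRun G η T π q Q) (i : Fin N) (s : S) (a : JointAction A)
    (t : Finset.Icc 1 T) : Q t i (Fin.last n) s a = G.reward (Fin.last n) i s a := by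
  obtain ⟨h1, h2⟩ := Finset.mem_Icc.1 t.2
  rw [hrun.Q_eq i _ s a h1 h2, dif_neg (by simp), add_zero]

/-- The value of the output policy is at least its average `Q`-estimate at the first step. -/
theorem le_value_certifiedPolicy (hrun : IsBMOFTRLRun G η T π q Q) (hT : 1 ≤ T) (i : Fin N) :
    ∑ j ∈ Finset.Icc 1 T, stepWeight (n + 1) T j * evalJoint (Q j i 0) (π j) 0 G.init ≤
      value G (certifiedPolicy T hT π) i := by
  let σ : Fin (n + 1) → ℕ → S → stdSimplex ℝ (JointAction A) := fun h j s => jointMixed (π j) h s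
  rw [value_eq_sum_chain G σ (certifiedPolicy T hT π) rfl (fun _ _ _ _ => rfl) i]
  -- Signs are reversed so that the supersolution bound becomes a lower bound; `Q` satisfies the
  -- recursion with equality.
  have hchain := sum_chain_le (chainInit G T σ) (chainInit_nonneg G σ) (chainKernel G T σ)
    (chainKernel_nonneg G σ) (sum_chainKernel G σ)
    (fun k x => -G.reward k i x.2.1 x.2.2) (fun k x => -Q x.1 i k x.2.1 x.2.2)
    (fun k x => by
      rw [sum_chainKernel_mul, hrun.Q_castSucc, neg_add, ← Finset.sum_neg_distrib]
      refine le_of_eq ?_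
      congr 1
      refine Finset.sum_congr rfl fun s' _ => ?_
      rw [← mul_neg, ← Finset.sum_neg_distrib]
      congr 1
      rw [← Finset.sum_congr rfl fun j _ => mul_neg _ _, ← sum_Icc_coe_stepWeight_mul (n + 1)
        (Finset.mem_Icc.1 x.1.2).2 fun j => -evalJoint (Q j i k.succ) (π j) k.succ s']
      refine Finset.sum_congr rfl fun j _ => ?_
      rw [evalJoint, ← Finset.sum_neg_distrib]
      congr 1
      exact Finset.sum_congr rfl fun a _ => by simp only [σ]; ring)
    (fun x => by rw [hrun.Q_last])
  rw [sum_chainInit_mul] at hchain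
  simp only [Finset.sum_neg_distrib, mul_neg, neg_le_neg_iff] at hchain
  refine le_trans (le_of_eq ?_) hchain
  rw [← sum_Icc_coe_stepWeight_mul (n + 1) le_rfl fun j => evalJoint (Q j i 0) (π j) 0 G.init]
  refine Finset.sum_congr rfl fun j _ => ?_
  rw [evalJoint]
  congr 1
  exact Finset.sum_congr rfl fun a _ => by simp only [σ]; ring

/-- A bound `K / τ` on all weighted swap regrets bounds the gain of a strategy modification. -/
theorem value_modify_sub_le (hrun : IsBMOFTRLRun G η T π q Q) (hT : 1 ≤ T) {K : ℝ} (hK : 0 ≤ K)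
    {i : Fin N} {φ : StrategyModification (n + 1) S A i}
    (hreg : ∀ (h : Fin (n + 1)) (s : S) (τ : ℕ), 1 ≤ τ → τ ≤ T →
      ∑ j ∈ Finset.Icc 1 τ, stepWeight (n + 1) τ j * ∑ c, (π j i h s).1 c *
        (evalOthers (Q j i h) (π j) h i s (φ h s c) - evalOthers (Q j i h) (π j) h i s c) ≤
          K / τ) :
    value G (modify i φ (certifiedPolicy T hT π)) i - value G (certifiedPolicy T hT π) i ≤
      2 * ((n + 1 : ℕ) : ℝ) * K / T := by
  let σ : Fin (n + 1) → ℕ → S → stdSimplex ℝ (JointAction A) := fun h j s =>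
    pushSimplex (fun a : JointAction A => Function.update a i (φ h s (a i))) (jointMixed (π j) h s)
  have hlow := hrun.le_value_certifiedPolicy hT i
  have hchain := sum_chain_le (chainInit G T σ) (chainInit_nonneg G σ) (chainKernel G T σ)
    (chainKernel_nonneg G σ) (sum_chainKernel G σ)
    (fun k x => G.reward k i x.2.1 x.2.2)
    -- The action at step `k` is already drawn here, so only the `n - k` later steps contribute to
    -- the gap.
    (fun k x => Q x.1 i k x.2.1 x.2.2 + gapCoeff (n + 1) K (n - k) / (x.1 : ℕ))
    (fun k x => by
      obtain ⟨h1, h2⟩ := Finset.mem_Icc.1 x.1.2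
      have hk : n - (k.castSucc : ℕ) = (n - (k.succ : ℕ)) + 1 := by
        simp only [Fin.val_castSucc, Fin.val_succ]
        omega
      rw [sum_chainKernel_mul, hrun.Q_castSucc, add_assoc, hk, gapCoeff_succ]
      refine add_le_add le_rfl ?_
      set D := (K + (1 + 1 / ((n + 1 : ℕ) : ℝ)) * gapCoeff (n + 1) K (n - (k.succ : ℕ)))
        / ((x.1 : ℕ) : ℝ)
      have hD : D = ∑ s', (G.trans k.castSucc x.2.1 x.2.2).1 s' * D := by
        rw [← Finset.sum_mul, (G.trans k.castSucc x.2.1 x.2.2).2.2, one_mul]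
      rw [hD, ← Finset.sum_add_distrib]
      refine Finset.sum_le_sum fun s' _ => ?_
      rw [← mul_add]
      exact mul_le_mul_of_nonneg_left (sum_modified_le hreg (gapCoeff_nonneg _ hK _) k.succ s' h1 h2)
        ((G.trans k.castSucc x.2.1 x.2.2).2.1 s'))
    (fun x => by
      rw [hrun.Q_last]
      exact le_add_of_nonneg_right (div_nonneg (gapCoeff_nonneg _ hK _) (by positivity)))
  rw [← value_eq_sum_chain G σ (modify i φ (certifiedPolicy T hT π)) rfl (fun _ _ _ _ => rfl) i,
    sum_chainInit_mul] at hchain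
  have hup := hchain.trans (sum_modified_le hreg (gapCoeff_nonneg _ hK _) 0 G.init hT le_rfl)
  rw [Fin.val_zero, Nat.sub_zero, ← gapCoeff_succ] at hup
  have h3 : gapCoeff (n + 1) K (n + 1) / (T : ℝ) ≤ 2 * ((n + 1 : ℕ) : ℝ) * K / T := by
    gcongr
    exact gapCoeff_self_le (by omega) hK
  linarith

end IsBMOFTRLRun

end Gap

end CEMarkov
-- Choice of η and the final constant.
open CEMarkov in
theorem theorem1 {N H : ℕ} (hN : 1 ≤ N) (hH : 1 ≤ H)
    {S : Type*} [Fintype S] {A : Fin N → Type*} [∀ i, Fintype (A i)] [∀ i, Nonempty (A i)]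
    (G : MarkovGame N H S A) (T : ℕ) (hT : 2 ≤ T) (η : ℝ)
    (hη : η = 1 / (256 * (N : ℝ) * H * Real.sqrt ((H : ℝ) * maxActions A)))
    (π : ℕ → ProductPolicy N H S A)
    (q : ℕ → (i : Fin N) → Fin H → S → A i → A i → ℝ)
    (Q : ℕ → Fin N → Fin H → S → JointAction A → ℝ)
    (hrun : IsBMOFTRLRun G η T π q Q) :
    ceGap G (certifiedPolicy T (Nat.one_le_of_lt hT) π) ≤
      6144 * (N : ℝ) * (H : ℝ) ^ (7 / 2 : ℝ) * (maxActions A : ℝ) ^ (5 / 2 : ℝ) *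
        Real.log T / T := by
  obtain ⟨n, rfl⟩ : ∃ n, H = n + 1 := ⟨H - 1, by omega⟩
  have hcard : ∀ i, (Fintype.card (A i) : ℝ) ≤ maxActions A := fun i => by
    exact_mod_cast Finset.le_sup (f := fun i => Fintype.card (A i)) (Finset.mem_univ i)
  have hA1 : (1 : ℝ) ≤ maxActions A := by
    refine le_trans ?_ (hcard ⟨0, hN⟩)
    exact_mod_cast Fintype.card_pos
  set B : ℝ := (maxActions A : ℝ) with hB
  set h : ℝ := ((n + 1 : ℕ) : ℝ) with hh
  have hh1 : 1 ≤ h := by rw [hh]; exact_mod_cast hH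
  have hN1 : (1 : ℝ) ≤ N := by exact_mod_cast hN
  have hT0 : (0 : ℝ) < T := by exact_mod_cast (by omega : 0 < T)
  have hlog : 0 ≤ Real.log T := Real.log_natCast_nonneg T
  have hs : 0 < Real.sqrt (h * B) := Real.sqrt_pos.2 (by positivity)
  have hη0 : 0 < η := by rw [hη]; positivity
  have hη2 : η ^ 2 * (65536 * N ^ 2 * h ^ 3 * B) = 1 := by
    have h1 : Real.sqrt (h * B) ^ 2 = h * B := Real.sq_sqrt (by positivity)
    rw [hη, div_pow, mul_pow, h1]
    field_simp
    norm_num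
  set K : ℝ := 3 * (h * B ^ 2 * Real.log T / η) with hK
  have hK0 : 0 ≤ K := by positivity
  have hgap : 2 * h * K / T ≤
      6144 * (N : ℝ) * h ^ (7 / 2 : ℝ) * B ^ (5 / 2 : ℝ) * Real.log T / T := by
    have e1 : h ^ (7 / 2 : ℝ) = h ^ 3 * Real.sqrt h := by
      rw [show (7 / 2 : ℝ) = (3 : ℕ) + 1 / 2 by norm_num, Real.rpow_add (by linarith),
        Real.rpow_natCast, Real.sqrt_eq_rpow]
    have e2 : B ^ (5 / 2 : ℝ) = B ^ 2 * Real.sqrt B := by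
      rw [show (5 / 2 : ℝ) = (2 : ℕ) + 1 / 2 by norm_num, Real.rpow_add (by linarith),
        Real.rpow_natCast, Real.sqrt_eq_rpow]
    -- The constant is 2 · 3 · 256 = 1536, with 256 coming from 1/η; the stated 6144 leaves a factor
    -- 4.
    have e3 : 2 * h * K / T =
        1536 * ((N : ℝ) * (h ^ 3 * Real.sqrt h) * (B ^ 2 * Real.sqrt B) * Real.log T / T) := by
      rw [hK, hη, Real.sqrt_mul (by linarith)]
      field_simp
      ring
    have e4 : 0 ≤ (N : ℝ) * (h ^ 3 * Real.sqrt h) * (B ^ 2 * Real.sqrt B) * Real.log T / T := by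
      positivity
    rw [e3, e1, e2]
    have e5 : 6144 * (N : ℝ) * (h ^ 3 * Real.sqrt h) * (B ^ 2 * Real.sqrt B) * Real.log T / T =
      6144 * ((N : ℝ) * (h ^ 3 * Real.sqrt h) * (B ^ 2 * Real.sqrt B) * Real.log T / T) := by ring
    rw [e5]
    linarith
  have : Nonempty (Fin N) := ⟨⟨0, hN⟩⟩
  refine ciSup_le fun i => ciSup_le fun φ => ?_
  refine (hrun.value_modify_sub_le (Nat.one_le_of_lt hT) hK0 fun k s τ hτ hτT => ?_).trans hgap
  exact hrun.swapRegret_le hH hT hη0 hη2 hcard hA1 i k s (φ k s) hτ hτT
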